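/- **Quantitative De Jong theorem I.** For every integer $p\ge 1$ there is a constant $C_p>0$, depending only on $p$, such that the following holds. Let $A$ be an at most countable set, let $E_0$ and $(E_a)_{a\in A}$ be Polish spaces with their Borel $\sigma$-fields, and let $Z$ be an $E_0$-valued random variable and $X=(X_a)_{a\in A}$ a family of random variables, $X_a$ being $E_a$-valued, all defined on a standard Borel probability space and such that the $X_a$ are conditionally independent given $Z$. For $K\subseteq A$ put $\mathcal G_K=\sigma(X_a,\,a\in K)\vee\sigma(Z)$. For $k\ge 0$ let $\mathfrak C_k$ be the set of all $\phi\in L^2$ of the form $\phi=\sum_{J\subseteq A,\,|J|=k}\psi_J$ (unconditional convergence in $L^2$), where each $\psi_J\in L^2$ is $\mathcal G_J$-measurable (up to a null set) and $\mathbb E[\psi_J\mid\mathcal G_K]=0$ for every $K\subseteq A$ with $J\not\subseteq K$. Let $F\in L^4$ be a degenerate U-statistic of order $p$, i.e. $F\in\mathfrak C_p$, with components $W_J$: $F=\sum_{|J|=p}W_J$. Assume $\mathbb E[F\mid Z]=0$ and $\mathbb E[F^2]=1$, and assume * (HC) there is $\kappa<\infty$ such that $W_J\in L^4$ and $\mathbb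 E[W_J^4]\le\kappa\,\mathbb E[W_J^2]^2$ for all $J\subseteq A$ with $|J|=p$; * (EGF) $F^2\in\bigoplus_{k=0}^{2p}\mathfrak C_k$. Let $$\rho=\Bigl(\sup_{a\in A}\ \sum_{J\ni a,\ |J|=p}\mathbb E[W_J^2]\Bigr)^{1/2}$$ be the maximal influence. Then $$d_W\bigl(F,\mathcal N(0,1)\bigr)\ \le\ \sqrt{\frac{2}{3\pi}}\,\sqrt{\bigl|\mathbb E[F^4]-3\bigr|}\;+\;C_p\,\sqrt{\kappa}\,\rho ,$$ where $d_W(F,\mathcal N(0,1))=\sup_h|\mathbb E[h(F)]-\mathbb E[h(N)]|$, with $N\sim\mathcal N(0,1)$ and the supremum over all 1-Lipschitz functions $h:\mathbb R\to\mathbb R$. -/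

import Mathlib

open MeasureTheory ProbabilityTheory Filter Topology
open scoped ENNReal

noncomputable section

/-- The 1-Wasserstein distance between two laws on the real line: the supremum of
`|∫ h dν₁ - ∫ h dν₂|` over all 1-Lipschitz functions `h`. It takes values in `[0, ∞]`, so that the
supremum is always meaningful. -/
def wassersteinDist (ν₁ ν₂ : Measure ℝ) : ℝ≥0∞ :=
  ⨆ (h : ℝ → ℝ) (_ : LipschitzWith 1 h), ENNReal.ofReal |∫ x, h x ∂ν₁ - ∫ x, h x ∂ν₂|

section Chaos

variable {Ω A E₀ : Type*} {E : A → Type*} [MeasurableSpace E₀] [∀ a, MeasurableSpace (E a)]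

/-- The σ-field `𝒢_K = σ(X_a, a ∈ K) ∨ σ(Z)` for a set `K` of indices. -/
abbrev condSigma (Z : Ω → E₀) (X : ∀ a, Ω → E a) (K : Set A) : MeasurableSpace Ω :=
  (⨆ a ∈ K, MeasurableSpace.comap (X a) inferInstance) ⊔ MeasurableSpace.comap Z inferInstance

variable [MeasurableSpace Ω]

/-- `F` is a degenerate U-statistic of order `k` given `Z`, with components `W J` (`|J| = k`):
`F = ∑_{|J| = k} W_J` with unconditional convergence in `L²`, where each `W_J` is square-integrable,
is `𝒢_J`-measurable up to a null set (so it is a function of `(X_a)_{a ∈ J}` and of `Z`), and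
satisfies `E[W_J | 𝒢_K] = 0` for every set `K` of indices that does not contain `J`. Only the
values of `W` at the sets of cardinality `k` matter. -/
structure IsDegenerateUStatistic (μ : Measure Ω) (Z : Ω → E₀) (X : ∀ a, Ω → E a) (k : ℕ)
    (W : Finset A → Ω → ℝ) (F : Ω → ℝ) : Prop where
  memLp_two : MemLp F 2 μ
  memLp_component : ∀ J : Finset A, J.card = k → MemLp (W J) 2 μ
  measurable_component : ∀ J : Finset A, J.card = k →
    AEStronglyMeasurable[condSigma Z X (J : Set A)] (W J) μ
  condExp_component : ∀ J : Finset A, J.card = k → ∀ K : Set A, ¬ (J : Set A) ⊆ K →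
    μ[W J | condSigma Z X K] =ᵐ[μ] 0
  tendsto_sum : Tendsto
    (fun S : Finset {J : Finset A // J.card = k} =>
      eLpNorm (fun ω => F ω - ∑ J ∈ S, W J.1 ω) 2 μ) atTop (𝓝 0)

/-- Membership in the `k`-th chaos `ℭ_k`; for `k = 0` these are the square-integrable functionals
of `Z`. -/
def MemChaos (μ : Measure Ω) (Z : Ω → E₀) (X : ∀ a, Ω → E a) (k : ℕ) (F : Ω → ℝ) : Prop :=
  ∃ W : Finset A → Ω → ℝ, IsDegenerateUStatistic μ Z X k W F

/-- The chaos eigenfunction condition `F² ∈ ℭ_0 ⊕ ℭ_1 ⊕ ⋯ ⊕ ℭ_{2p}`. -/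
def IsChaosEigenfunction (μ : Measure Ω) (Z : Ω → E₀) (X : ∀ a, Ω → E a) (p : ℕ)
    (F : Ω → ℝ) : Prop :=
  ∃ G : ℕ → Ω → ℝ, (∀ k ≤ 2 * p, MemChaos μ Z X k (G k)) ∧
    (fun ω => F ω ^ 2) =ᵐ[μ] fun ω => ∑ k ∈ Finset.range (2 * p + 1), G k ω

/-- Hypercontractivity with constant `κ`: `sup_{|J| = p} E[W_J⁴] / E[W_J²]² ≤ κ`, in product form,
so that components that vanish almost surely do not matter. -/
def IsHypercontractive (μ : Measure Ω) (p : ℕ) (W : Finset A → Ω → ℝ) (κ : ℝ) : Prop :=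
  ∀ J : Finset A, J.card = p →
    MemLp (W J) 4 μ ∧ ∫ ω, W J ω ^ 4 ∂μ ≤ κ * (∫ ω, W J ω ^ 2 ∂μ) ^ 2

/-- The maximal influence `ρ = (sup_{a ∈ A} ∑_{J ∋ a, |J| = p} E[W_J²])^{1/2}`. The supremum is
computed in `[0, ∞]`; for the components of a degenerate U-statistic `F` it is at most `E[F²]`. -/
def maxInfluence (μ : Measure Ω) (p : ℕ) (W : Finset A → Ω → ℝ) : ℝ :=
  √(⨆ a : A, ∑' J : {J : Finset A // J.card = p ∧ a ∈ J},
      ∫⁻ ω, ENNReal.ofReal (W J.1 ω ^ 2) ∂μ).toReal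

end Chaos

end

/-!
Write `D_a f = f - E[f | 𝒢_{A ∖ {a}}]`. A component with index set `J` is fixed by `D_a` for `a ∈ J`
and killed by `D_a` for `a ∉ J`, so the chaos of order `k` consists of eigenvectors of `∑_a D_a`
with eigenvalue `k`. Tested against a square-integrable `φ`, this reads
`∑_a E[D_a F φ] = k E[F φ]` (`IsDegenerateUStatistic.hasSum_integral_coordResidual_mul`). The
identity needs no commutation of the `D_a`, and it contains the orthogonality of the chaoses.

Let `f` solve Stein's equation for a smooth 1-Lipschitz test function, with `|f'| ≤ √(2/π)` and `f'`
Lipschitz (`exists_stein_solution`). Expanding `f` around `E[F | 𝒢_{A ∖ {a}}]` in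
`p E[F f(F)] = ∑_a E[D_a F f(F)]` gives `E[F f(F)] = E[f'(F) Γ] + O(∑_a E|D_a F|³)`, where
`Γ = ∑_k (1 - k / (2p)) G_k` is the carré du champ of `F`, normalized by `p`, and `F² = ∑_k G_k` is
the decomposition into chaoses of order at most `2p`. Hence the distance is at most
`√(2/π) E[(1 - Γ)²]^{1/2}` and the remainder.

For the first term, `0 ≤ 1 - k / (2p) ≤ 1` yields
`E[(1 - Γ)²] ≤ E[F⁴] - 1 - (2p)⁻¹ ∑_a E[(D_a F²)²]`, and the chain rule for the cube, valid up to
fourth powers of `D_a F`, yields `p E[F⁴] ≤ (3/4) ∑_a E[(D_a F²)²] + ∑_a E[(D_a F)⁴]`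
(`IsDegenerateUStatistic.mul_integral_pow_four_le`). Together these give
`E[(1 - Γ)²] ≤ (E[F⁴] - 3) / 3 + O(∑_a E[(D_a F)⁴])`.

It remains to bound `∑_a E[(D_a F)⁴]` by a multiple of `κ ρ²`. A Bonami-type induction on the
coordinates (`IsDegenerateUStatistic.sqrt_integral_sum_pow_four_le`) reduces the fourth moment of a
sum of components to those of the single components, so that
`E[(D_a F)⁴] ≤ 16^p κ E[(D_a F)²]²`; here `E[(D_a F)²] ≤ ρ²` is the influence of `a`, and the
influences sum up to `p`.
-/

/-! ### Integrability of products -/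

section Products

variable {Ω : Type*} {mΩ : MeasurableSpace Ω} {μ : Measure Ω} {f g : Ω → ℝ}

lemma MeasureTheory.MemLp.mul_memLp_two (hf : MemLp f 4 μ) (hg : MemLp g 4 μ) :
    MemLp (fun ω => f ω * g ω) 2 μ := by
  have : ENNReal.HolderTriple 4 4 2 := ⟨by
    rw [← ENNReal.toReal_eq_toReal_iff' (by simp) (by simp),
      ENNReal.toReal_add (by simp) (by simp)]
    simp; norm_num⟩
  exact hg.mul' hf

lemma MeasureTheory.MemLp.sq_memLp_two (hf : MemLp f 4 μ) : MemLp (fun ω => f ω ^ 2) 2 μ := by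
  simpa only [sq] using MemLp.mul_memLp_two hf hf

lemma MeasureTheory.MemLp.integrable_mul_two (hf : MemLp f 2 μ) (hg : MemLp g 2 μ) :
    Integrable (fun ω => f ω * g ω) μ := hf.integrable_mul hg

lemma MeasureTheory.MemLp.integrable_pow_four (hf : MemLp f 4 μ) :
    Integrable (fun ω => f ω ^ 4) μ := by
  refine (MemLp.integrable_mul_two hf.sq_memLp_two hf.sq_memLp_two).congr (.of_forall fun ω => ?_)
  simp only; ring

lemma MeasureTheory.MemLp.comp_of_abs_le [IsFiniteMeasure μ] {φ : ℝ → ℝ} {c : ℝ}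
    (hφ : Continuous φ)
    (hc : ∀ x, |φ x| ≤ c) (hf : AEStronglyMeasurable f μ) (q : ℝ≥0∞) :
    MemLp (fun ω => φ (f ω)) q μ :=
  MemLp.of_bound (hφ.comp_aestronglyMeasurable hf) c (.of_forall fun ω => by simpa using hc (f ω))

/-- The Cauchy–Schwarz inequality. -/
lemma sq_integral_mul_le (hf : MemLp f 2 μ) (hg : MemLp g 2 μ) :
    (∫ ω, f ω * g ω ∂μ) ^ 2 ≤ (∫ ω, f ω ^ 2 ∂μ) * ∫ ω, g ω ^ 2 ∂μ := by
  have h1 := hf.integrable_sq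
  have h2 := hg.integrable_sq
  have h3 := MemLp.integrable_mul_two hf hg
  have := discrim_le_zero (a := ∫ ω, g ω ^ 2 ∂μ) (b := 2 * ∫ ω, f ω * g ω ∂μ)
    (c := ∫ ω, f ω ^ 2 ∂μ) fun t => by
      have : 0 ≤ ∫ ω, (t * t * g ω ^ 2 + 2 * t * (f ω * g ω) + f ω ^ 2) ∂μ :=
        integral_nonneg fun ω => by
          have : 0 ≤ (t * g ω + f ω) ^ 2 := sq_nonneg _
          simp only [Pi.zero_apply]; nlinarith
      rw [integral_add ((h2.const_mul _).fun_add (h3.const_mul _)) h1,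
        integral_add (h2.const_mul _) (h3.const_mul _), integral_const_mul,
        integral_const_mul] at this
      linarith
  rw [discrim] at this
  nlinarith

lemma abs_integral_mul_le (hf : MemLp f 2 μ) (hg : MemLp g 2 μ) :
    |∫ ω, f ω * g ω ∂μ| ≤ √(∫ ω, f ω ^ 2 ∂μ) * √(∫ ω, g ω ^ 2 ∂μ) := by
  rw [← Real.sqrt_mul (integral_nonneg fun ω => sq_nonneg _)]
  exact Real.abs_le_sqrt (sq_integral_mul_le hf hg)

end Products

/-! ### Residuals of conditional expectations -/

section Residual

variable {Ω : Type*} {m mΩ : MeasurableSpace Ω} {μ : Measure Ω} {f g : Ω → ℝ}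

/-- The residual `f - E[f | m]`. For `m = 𝒢_{A ∖ {a}}` it measures the dependence of `f` on the
coordinate `a`. -/
noncomputable def condResidual (m : MeasurableSpace Ω) {mΩ : MeasurableSpace Ω} (μ : Measure Ω)
    (f : Ω → ℝ) : Ω → ℝ := fun ω => f ω - (μ[f | m]) ω

lemma MeasureTheory.MemLp.condResidual {q : ℝ≥0∞} (hq : 1 ≤ q) (hf : MemLp f q μ) :
    MemLp (condResidual m μ f) q μ := hf.sub (hf.condExp hq)

variable [IsProbabilityMeasure μ]

lemma integral_mul_eq_zero_of_condExp_eq_zero (hm : m ≤ mΩ) (hg : AEStronglyMeasurable[m] g μ)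
    (hf : Integrable f μ) (hgf : Integrable (fun ω => g ω * f ω) μ) (h0 : μ[f | m] =ᵐ[μ] 0) :
    ∫ ω, g ω * f ω ∂μ = 0 := by
  rw [← integral_condExp hm]
  refine integral_eq_zero_of_ae ?_
  filter_upwards [condExp_mul_of_aestronglyMeasurable_left hg hgf hf, h0] with ω h1 h2
  change (μ[g * f | m]) ω = 0
  simp [h1, h2]

lemma integral_mul_condExp (hm : m ≤ mΩ) (hg : AEStronglyMeasurable[m] g μ)
    (hf : Integrable f μ) (hgf : Integrable (fun ω => g ω * f ω) μ) :
    ∫ ω, g ω * (μ[f | m]) ω ∂μ = ∫ ω, g ω * f ω ∂μ := by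
  rw [← integral_condExp hm (f := fun ω => g ω * f ω)]
  exact integral_congr_ae (condExp_mul_of_aestronglyMeasurable_left hg hgf hf).symm

lemma condExp_condResidual (hm : m ≤ mΩ) (hf : Integrable f μ) :
    μ[condResidual m μ f | m] =ᵐ[μ] 0 := by
  have h := condExp_sub hf (integrable_condExp (m := m) (f := f) (μ := μ)) m
  rw [condExp_of_stronglyMeasurable hm stronglyMeasurable_condExp integrable_condExp] at h
  exact h.trans (.of_forall fun ω => by simp)

lemma integral_condResidual_mul_comm (hm : m ≤ mΩ) (hf : MemLp f 2 μ) (hg : MemLp g 2 μ) :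
    ∫ ω, condResidual m μ f ω * g ω ∂μ = ∫ ω, f ω * condResidual m μ g ω ∂μ := by
  have hf' := hf.condExp (m := m) one_le_two
  have hg' := hg.condExp (m := m) one_le_two
  have h1 := integral_mul_condExp hm (stronglyMeasurable_condExp (μ := μ) (f := f)
    (m := m)).aestronglyMeasurable (hg.integrable one_le_two) (hf'.integrable_mul_two hg)
  have h2 := integral_mul_condExp hm (stronglyMeasurable_condExp (μ := μ) (f := g)
    (m := m)).aestronglyMeasurable (hf.integrable one_le_two) (hg'.integrable_mul_two hf)
  simp only [condResidual, sub_mul, mul_sub]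
  rw [integral_sub (hf.integrable_mul_two hg) (hf'.integrable_mul_two hg),
    integral_sub (hf.integrable_mul_two hg) (hf.integrable_mul_two hg'), ← h1]
  simp only [mul_comm (f _)]
  rw [← h2]
  simp only [mul_comm ((μ[g | m]) _)]

lemma integral_condResidual_sq (hm : m ≤ mΩ) (hf : MemLp f 2 μ) :
    ∫ ω, condResidual m μ f ω ^ 2 ∂μ = ∫ ω, condResidual m μ f ω * f ω ∂μ := by
  have hD := MemLp.condResidual (m := m) one_le_two hf
  have hB := hf.condExp (m := m) one_le_two
  have h := integral_mul_eq_zero_of_condExp_eq_zero hm (stronglyMeasurable_condExp (μ := μ)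
    (f := f) (m := m)).aestronglyMeasurable (hD.integrable one_le_two) (hB.integrable_mul_two hD)
    (condExp_condResidual hm (hf.integrable one_le_two))
  rw [← sub_eq_zero, ← integral_sub hD.integrable_sq (hD.integrable_mul_two hf), ← neg_eq_zero,
    ← h, ← integral_neg]
  refine integral_congr_ae (.of_forall fun ω => ?_)
  simp only [condResidual]; ring

lemma integral_condExp_sq_le (hm : m ≤ mΩ) (hf : MemLp f 2 μ) :
    ∫ ω, (μ[f | m]) ω ^ 2 ∂μ ≤ ∫ ω, f ω ^ 2 ∂μ := by
  have hB := hf.condExp (m := m) one_le_two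
  have h := integral_mul_condExp hm (stronglyMeasurable_condExp (μ := μ) (f := f)
    (m := m)).aestronglyMeasurable (hf.integrable one_le_two) (hB.integrable_mul_two hf)
  have h2 : 0 ≤ ∫ ω, ((f ω ^ 2 - 2 * ((μ[f | m]) ω * f ω)) + (μ[f | m]) ω * (μ[f | m]) ω) ∂μ :=
    integral_nonneg fun ω => by
      have := sq_nonneg (f ω - (μ[f | m]) ω)
      simp only [Pi.zero_apply]; nlinarith
  rw [integral_add (hf.integrable_sq.sub' ((hB.integrable_mul_two hf).const_mul 2))
    (hB.integrable_mul_two hB), integral_sub hf.integrable_sq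
    ((hB.integrable_mul_two hf).const_mul 2), integral_const_mul, h] at h2
  simp only [sq ((μ[f | m]) _)]
  linarith

/-- The residual of a square, in terms of the conditional mean `B`, the residual `D` and the
conditional variance `V`. -/
lemma condResidual_sq_ae_eq (hm : m ≤ mΩ) (hf : MemLp f 2 μ) :
    condResidual m μ (fun ω => f ω ^ 2) =ᵐ[μ] fun ω =>
      2 * (μ[f | m]) ω * condResidual m μ f ω + condResidual m μ f ω ^ 2
        - (μ[fun ω => condResidual m μ f ω ^ 2 | m]) ω := by
  have hD := MemLp.condResidual (m := m) one_le_two hf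
  have hB := hf.condExp (m := m) one_le_two
  have hBm := (stronglyMeasurable_condExp (μ := μ) (f := f) (m := m))
  have hBB : Integrable (fun ω => (μ[f | m]) ω ^ 2) μ := hB.integrable_sq
  have hBD : Integrable (fun ω => (μ[f | m]) ω * condResidual m μ f ω) μ :=
    hB.integrable_mul_two hD
  have e : (fun ω => f ω ^ 2) = ((fun ω => (μ[f | m]) ω ^ 2)
      + (2 : ℝ) • fun ω => (μ[f | m]) ω * condResidual m μ f ω)
      + fun ω => condResidual m μ f ω ^ 2 := by
    ext ω; simp [condResidual]; ring
  have h1 := condExp_add (hBB.add (hBD.smul (2 : ℝ))) hD.integrable_sq m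
  have h2 := condExp_add hBB (hBD.smul (2 : ℝ)) m
  have h3 := condExp_smul (μ := μ) (2 : ℝ) (fun ω => (μ[f | m]) ω * condResidual m μ f ω) m
  have h4 := condExp_mul_of_aestronglyMeasurable_left hBm.aestronglyMeasurable hBD
    (hD.integrable one_le_two)
  have h5 := condExp_condResidual hm (hf.integrable one_le_two)
  have h6 := condExp_of_stronglyMeasurable hm (hBm.pow 2) hBB
  rw [← e] at h1
  filter_upwards [h1, h2, h3, h4, h5] with ω h1 h2 h3 h4 h5
  have h4' : (μ[fun ω => (μ[f | m]) ω * condResidual m μ f ω | m]) ω = 0 := by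
    change (μ[(μ[f | m]) * condResidual m μ f | m]) ω = 0
    rw [h4]; simp [h5]
  have h6' : (μ[fun ω => (μ[f | m]) ω ^ 2 | m]) ω = (μ[f | m]) ω ^ 2 := congrFun h6 ω
  rw [Pi.add_apply] at h1 h2
  rw [Pi.smul_apply, h4'] at h3
  rw [condResidual, h1, h2, h3, h6']
  simp only [condResidual]; simp; ring

/-- A truncated form of `E[D F³] ≤ (3/4) E[(D(F²))²] + E[D⁴]`: replacing the cube by a bounded `φ`
can only decrease the left-hand side when `x ↦ x³ - φ x` is monotone. -/
lemma integral_condResidual_mul_comp_le (hm : m ≤ mΩ) (hf : MemLp f 4 μ) {φ : ℝ → ℝ} {M : ℝ}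
    (hφ : Continuous φ) (hM : ∀ x, |φ x| ≤ M) (hmono : Monotone fun x => x ^ 3 - φ x) :
    ∫ ω, condResidual m μ f ω * φ (f ω) ∂μ ≤
      3 / 4 * ∫ ω, condResidual m μ (fun ω => f ω ^ 2) ω ^ 2 ∂μ
        + ∫ ω, condResidual m μ f ω ^ 4 ∂μ := by
  have h24 : (2 : ℝ≥0∞) ≤ 4 := by norm_num
  have h14 : (1 : ℝ≥0∞) ≤ 4 := by norm_num
  have hf2 : MemLp f 2 μ := hf.mono_exponent h24
  have hD := MemLp.condResidual (m := m) h14 hf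
  have hD2 := hD.mono_exponent h24
  have hB := hf.condExp (m := m) h14
  have hBm := (stronglyMeasurable_condExp (μ := μ) (f := f) (m := m)).aestronglyMeasurable
    (μ := μ)
  have hu := MemLp.condResidual (m := m) one_le_two hf.sq_memLp_two
  have hV := hD.sq_memLp_two.condExp (m := m) one_le_two
  have hVm := (stronglyMeasurable_condExp (μ := μ) (f := fun ω => condResidual m μ f ω ^ 2)
    (m := m)).aestronglyMeasurable (μ := μ)
  have hsq := condResidual_sq_ae_eq hm hf2
  have h0 := condExp_condResidual hm (hf.integrable h14)
  set D := condResidual m μ f with hDdef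
  set B := μ[f | m] with hBdef
  set V := μ[fun ω => D ω ^ 2 | m]
  have hDB : ∀ ω, f ω = B ω + D ω := fun ω => by simp [hDdef, condResidual, hBdef]
  have hφB : MemLp (fun ω => φ (B ω)) 2 μ := MemLp.comp_of_abs_le hφ hM hB.1 2
  have hφf : MemLp (fun ω => φ (f ω)) 2 μ := MemLp.comp_of_abs_le hφ hM hf.1 2
  have i1 : Integrable (fun ω => B ω ^ 3 * D ω) μ :=
    (MemLp.integrable_mul_two hB.sq_memLp_two (hB.mul_memLp_two hD)).congr
      (.of_forall fun ω => by simp only; ring)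
  have i2 : Integrable (fun ω => (B ω * V ω) * D ω) μ :=
    (MemLp.integrable_mul_two hV (hB.mul_memLp_two hD)).congr
      (.of_forall fun ω => by simp only; ring)
  have i3 : Integrable (fun ω => φ (B ω) * D ω) μ := hφB.integrable_mul_two hD2
  have i4 : Integrable (fun ω => D ω * φ (f ω)) μ := hD2.integrable_mul_two hφf
  have e1 := integral_mul_eq_zero_of_condExp_eq_zero hm (hBm.pow 3) (hD.integrable h14) i1 h0
  have e2 := integral_mul_eq_zero_of_condExp_eq_zero hm (hBm.mul hVm) (hD.integrable h14) i2 h0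
  have e3 := integral_mul_eq_zero_of_condExp_eq_zero hm (hφ.comp_aestronglyMeasurable hBm)
    (hD.integrable h14) i3 h0
  have i5 := (((hu.integrable_sq.const_mul (3 / 4)).fun_add hD.integrable_pow_four).fun_add
    i1).fun_add (i2.const_mul 3)
  -- the terms `B ^ 3 * D`, `B * V * D` and `φ B * D` integrate to zero and are added in order to
  -- make the inequality hold pointwise
  have key : ∫ ω, D ω * φ (f ω) ∂μ ≤ ∫ ω, ((((3 / 4 * condResidual m μ (fun ω => f ω ^ 2) ω ^ 2
      + D ω ^ 4) + B ω ^ 3 * D ω) + 3 * ((B ω * V ω) * D ω))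
      - (B ω ^ 3 * D ω - φ (B ω) * D ω)) ∂μ := by
    refine integral_mono_ae i4 (i5.sub' (i1.sub' i3)) ?_
    filter_upwards [hsq] with ω hω
    rw [hω]
    -- `F - B = D`, so the factors have the same sign
    have hmon : 0 ≤ D ω * ((f ω ^ 3 - φ (f ω)) - (B ω ^ 3 - φ (B ω))) := by
      rcases le_total 0 (D ω) with h | h
      · exact mul_nonneg h (sub_nonneg.2 (hmono (by rw [hDB]; linarith)))
      · exact mul_nonneg_of_nonpos_of_nonpos h (sub_nonpos.2 (hmono (by rw [hDB]; linarith)))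
    have hsqr : 0 ≤ 3 / 4 * (D ω ^ 2 - V ω) ^ 2 := by positivity
    have hid : 3 / 4 * (2 * B ω * D ω + D ω ^ 2 - V ω) ^ 2 + D ω ^ 4 + B ω ^ 3 * D ω
        + 3 * (B ω * V ω * D ω) = D ω * f ω ^ 3 + 3 / 4 * (D ω ^ 2 - V ω) ^ 2 := by
      rw [hDB]; ring
    linarith
  have i6 := (hu.integrable_sq.const_mul (3 / 4)).fun_add hD.integrable_pow_four
  rw [integral_sub i5 (i1.sub' i3), integral_sub i1 i3,
    integral_add (i6.fun_add i1) (i2.const_mul 3), integral_add i6 i1, integral_add (hu.integrable_sq.const_mul (3 / 4)) hD.integrable_pow_four,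
    integral_const_mul, integral_const_mul] at key
  change _ ≤ _ + _ + ∫ ω, B ω ^ 3 * D ω ∂μ + _ - _ at key
  have e1' : ∫ ω, B ω ^ 3 * D ω ∂μ = 0 := e1
  have e2' : ∫ ω, (B ω * V ω) * D ω ∂μ = 0 := e2
  rw [e1', e2', e3] at key
  linarith

lemma abs_sub_sub_deriv_mul_le {f f' : ℝ → ℝ} {K : ℝ} (hf : ∀ x, HasDerivAt f (f' x) x)
    (hlip : ∀ x y, |f' x - f' y| ≤ K * |x - y|) (x y : ℝ) :
    |f x - f y - f' y * (x - y)| ≤ K * (x - y) ^ 2 := by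
  have hK : 0 ≤ K := by simpa using (abs_nonneg _).trans (hlip 1 0)
  have h := (convex_uIcc y x).norm_image_sub_le_of_norm_hasDerivWithin_le
    (f := fun t => f t - f' y * t) (f' := fun t => f' t - f' y) (C := K * |x - y|)
    (fun t _ => ((hf t).sub (by simpa using (hasDerivAt_id t).const_mul (f' y))).hasDerivWithinAt)
    (fun t ht => (hlip t y).trans
      (mul_le_mul_of_nonneg_left (Set.abs_sub_left_of_mem_uIcc ht) hK))
    Set.left_mem_uIcc Set.right_mem_uIcc
  rw [Real.norm_eq_abs, Real.norm_eq_abs] at h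
  rw [← sq_abs (x - y), sq, ← mul_assoc]
  refine le_trans (le_of_eq ?_) h
  congr 1; ring

/-- A second order Taylor expansion of `f` around the conditional mean. The weight
`F D - D(F²) / 2` equals `(D² + E[D² | m]) / 2`. -/
lemma abs_integral_condResidual_mul_comp_sub_le (hm : m ≤ mΩ) {F : Ω → ℝ} (hF : MemLp F 4 μ)
    {f f' : ℝ → ℝ} {b c : ℝ} (hf : ∀ x, HasDerivAt f (f' x) x) (hb : ∀ x, |f x| ≤ b)
    (hf' : Continuous f') (hc : ∀ x, |f' x| ≤ c) (hlip : ∀ x y, |f' x - f' y| ≤ 4 * |x - y|)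
    {η : ℝ} (hη : 0 < η) :
    |∫ ω, condResidual m μ F ω * f (F ω) ∂μ - ∫ ω, f' (F ω) * (F ω * condResidual m μ F ω
        - condResidual m μ (fun ω => F ω ^ 2) ω / 2) ∂μ| ≤
      4 * (η * ∫ ω, condResidual m μ F ω ^ 2 ∂μ + η⁻¹ * ∫ ω, condResidual m μ F ω ^ 4 ∂μ) := by
  have h24 : (2 : ℝ≥0∞) ≤ 4 := by norm_num
  have h14 : (1 : ℝ≥0∞) ≤ 4 := by norm_num
  have hf2 : MemLp F 2 μ := hF.mono_exponent h24
  have hD := MemLp.condResidual (m := m) h14 hF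
  have hD2 := hD.mono_exponent h24
  have hB := hF.condExp (m := m) h14
  have hBm := (stronglyMeasurable_condExp (μ := μ) (f := F) (m := m)).aestronglyMeasurable
    (μ := μ)
  have hu := MemLp.condResidual (m := m) one_le_two hF.sq_memLp_two
  have hV := hD.sq_memLp_two.condExp (m := m) one_le_two
  have hV4 := integral_condExp_sq_le hm hD.sq_memLp_two
  have hsq := condResidual_sq_ae_eq hm hf2
  have h0 := condExp_condResidual hm (hF.integrable h14)
  have hVnn : 0 ≤ᵐ[μ] μ[fun ω => condResidual m μ F ω ^ 2 | m] :=
    condExp_nonneg (.of_forall fun ω => sq_nonneg _)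
  set D := condResidual m μ F with hDdef
  set B := μ[F | m] with hBdef
  set V := μ[fun ω => D ω ^ 2 | m]
  have hDB : ∀ ω, F ω = B ω + D ω := fun ω => by simp [hDdef, condResidual, hBdef]
  have hfc : Continuous f := continuous_iff_continuousAt.2 fun x => (hf x).continuousAt
  have m1 : MemLp (fun ω => f (B ω)) 2 μ := MemLp.comp_of_abs_le hfc hb hB.1 2
  have m2 : MemLp (fun ω => f' (B ω)) 2 μ := MemLp.comp_of_abs_le hf' hc hB.1 2
  have m3 : MemLp (fun ω => f (F ω)) 2 μ := MemLp.comp_of_abs_le hfc hb hF.1 2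
  have m4 : MemLp (fun ω => f' (F ω)) 2 μ := MemLp.comp_of_abs_le hf' hc hF.1 2
  have i1 : Integrable (fun ω => f (B ω) * D ω) μ := m1.integrable_mul_two hD2
  have i2 : Integrable (fun ω => f' (B ω) * D ω ^ 2) μ := m2.integrable_mul_two hD.sq_memLp_two
  have i3 : Integrable (fun ω => f' (B ω) * V ω) μ := m2.integrable_mul_two hV
  have i4 : Integrable (fun ω => D ω * f (F ω)) μ := hD2.integrable_mul_two m3
  have i5 : Integrable (fun ω => f' (F ω) * (F ω * D ω
      - condResidual m μ (fun ω => F ω ^ 2) ω / 2)) μ :=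
    m4.integrable_mul_two ((hF.mul_memLp_two hD).sub (by
      simpa only [div_eq_inv_mul] using hu.const_mul (2⁻¹)))
  have e1 := integral_mul_eq_zero_of_condExp_eq_zero hm (hfc.comp_aestronglyMeasurable hBm)
    (hD.integrable h14) i1 h0
  have e2 := integral_mul_condExp hm (hf'.comp_aestronglyMeasurable hBm)
    hD2.integrable_sq i2
  have e2' : ∫ ω, f' (B ω) * V ω ∂μ = ∫ ω, f' (B ω) * D ω ^ 2 ∂μ := e2
  have i6 := i4.sub' i5
  have i7 := (i1.fun_add ((i2.sub' i3).const_mul (1 / 2)))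
  have e3 : ∫ ω, D ω * f (F ω) ∂μ - ∫ ω, f' (F ω) * (F ω * D ω
        - condResidual m μ (fun ω => F ω ^ 2) ω / 2) ∂μ
      = ∫ ω, ((D ω * f (F ω) - f' (F ω) * (F ω * D ω
        - condResidual m μ (fun ω => F ω ^ 2) ω / 2))
        - (f (B ω) * D ω + 1 / 2 * (f' (B ω) * D ω ^ 2 - f' (B ω) * V ω))) ∂μ := by
    rw [integral_sub i6 i7, integral_sub i4 i5, integral_add i1 ((i2.sub' i3).const_mul (1 / 2)),
      integral_const_mul, integral_sub i2 i3, e1, e2']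
    ring
  rw [e3]
  have iD2 := hD2.integrable_sq
  have iD4 := hD.integrable_pow_four
  have iV2 := hV.integrable_sq
  have j1 := (iD2.const_mul (4 * η)).fun_add ((iD4.const_mul (3 * η⁻¹)).fun_add (iV2.const_mul η⁻¹))
  rw [← Real.norm_eq_abs]
  refine (norm_integral_le_of_norm_le j1 ?_).trans ?_
  · filter_upwards [hsq, hVnn] with ω hω hv
    have hv : 0 ≤ V ω := hv
    rw [hω, Real.norm_eq_abs]
    have t1 := abs_sub_sub_deriv_mul_le hf hlip (F ω) (B ω)
    have t2 := hlip (F ω) (B ω)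
    have hFB : F ω - B ω = D ω := by rw [hDB]; ring
    rw [hFB] at t1 t2
    have e : D ω * f (F ω) - f' (F ω) * (F ω * D ω - (2 * B ω * D ω + D ω ^ 2 - V ω) / 2)
        - (f (B ω) * D ω + 1 / 2 * (f' (B ω) * D ω ^ 2 - f' (B ω) * V ω))
        = D ω * (f (F ω) - f (B ω) - f' (B ω) * D ω)
          + (f' (B ω) - f' (F ω)) * ((D ω ^ 2 + V ω) / 2) := by
      rw [show F ω * D ω = (B ω + D ω) * D ω by rw [hDB]]; ring
    rw [e]
    have s1 : |D ω * (f (F ω) - f (B ω) - f' (B ω) * D ω)| ≤ |D ω| * (4 * D ω ^ 2) := by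
      rw [abs_mul]; gcongr
    have s2 : |(f' (B ω) - f' (F ω)) * ((D ω ^ 2 + V ω) / 2)|
        ≤ 4 * |D ω| * ((D ω ^ 2 + V ω) / 2) := by
      rw [abs_mul, abs_sub_comm, abs_of_nonneg (a := (D ω ^ 2 + V ω) / 2) (by positivity)]
      gcongr
    have amgm : ∀ y : ℝ, 2 * (|D ω| * y) ≤ η * D ω ^ 2 + η⁻¹ * y ^ 2 := fun y => by
      have h1 : η * D ω ^ 2 + η⁻¹ * y ^ 2 - 2 * (|D ω| * y) = η⁻¹ * (η * |D ω| - y) ^ 2 := by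
        rw [← sq_abs (D ω)]; field_simp; ring
      have h2 : 0 ≤ η⁻¹ * (η * |D ω| - y) ^ 2 := by positivity
      linarith
    have a1 := amgm (D ω ^ 2)
    have a2 := amgm (V ω)
    refine (abs_add_le _ _).trans ?_
    linarith
  · rw [integral_add (iD2.const_mul _) ((iD4.const_mul _).fun_add (iV2.const_mul _)),
      integral_add (iD4.const_mul _) (iV2.const_mul _), integral_const_mul, integral_const_mul,
      integral_const_mul]
    have : ∫ ω, (D ω ^ 2) ^ 2 ∂μ = ∫ ω, D ω ^ 4 ∂μ := by simp only [← pow_mul]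
    rw [this] at hV4
    have := mul_le_mul_of_nonneg_left hV4 (inv_nonneg.2 hη.le)
    have hV4' : η⁻¹ * ∫ ω, V ω ^ 2 ∂μ ≤ η⁻¹ * ∫ ω, D ω ^ 4 ∂μ := this
    linarith

/-- The two-point step of a Bonami-type inequality: `‖Y + T‖₄² ≤ ‖Y‖₄² + 4 ‖T‖₄²` when `Y` is
`m`-measurable and `E[T | m] = 0`. -/
lemma sqrt_integral_add_pow_four_le (hm : m ≤ mΩ) {Y T : Ω → ℝ} (hY : MemLp Y 4 μ)
    (hT : MemLp T 4 μ) (hYm : AEStronglyMeasurable[m] Y μ) (hT0 : μ[T | m] =ᵐ[μ] 0) :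
    √(∫ ω, (Y ω + T ω) ^ 4 ∂μ) ≤ √(∫ ω, Y ω ^ 4 ∂μ) + 4 * √(∫ ω, T ω ^ 4 ∂μ) := by
  have h14 : (1 : ℝ≥0∞) ≤ 4 := by norm_num
  have i1 : Integrable (fun ω => Y ω ^ 3 * T ω) μ :=
    (MemLp.integrable_mul_two hY.sq_memLp_two (hY.mul_memLp_two hT)).congr
      (.of_forall fun ω => by simp only; ring)
  have e1 : ∫ ω, Y ω ^ 3 * T ω ∂μ = 0 :=
    integral_mul_eq_zero_of_condExp_eq_zero hm (hYm.pow 3) (hT.integrable h14) i1 hT0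
  have i2 : Integrable (fun ω => Y ω ^ 2 * T ω ^ 2) μ :=
    MemLp.integrable_mul_two hY.sq_memLp_two hT.sq_memLp_two
  have cs := (le_abs_self _).trans (abs_integral_mul_le hY.sq_memLp_two hT.sq_memLp_two)
  simp only [← pow_mul] at cs
  norm_num at cs
  have iY := hY.integrable_pow_four
  have iT := hT.integrable_pow_four
  have key : ∫ ω, (Y ω + T ω) ^ 4 ∂μ ≤ ∫ ω, (((Y ω ^ 4 + 4 * (Y ω ^ 3 * T ω))
      + 8 * (Y ω ^ 2 * T ω ^ 2)) + 3 * T ω ^ 4) ∂μ := by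
    refine integral_mono (hY.add hT).integrable_pow_four
      (((iY.fun_add (i1.const_mul 4)).fun_add (i2.const_mul 8)).fun_add (iT.const_mul 3))
      fun ω => ?_
    have : 0 ≤ 2 * T ω ^ 2 * (Y ω - T ω) ^ 2 := by positivity
    simp only
    linarith
  rw [integral_add ((iY.fun_add (i1.const_mul 4)).fun_add (i2.const_mul 8)) (iT.const_mul 3),
    integral_add (iY.fun_add (i1.const_mul 4)) (i2.const_mul 8), integral_add iY (i1.const_mul 4),
    integral_const_mul, integral_const_mul, integral_const_mul, e1] at key
  have hY0 : 0 ≤ ∫ ω, Y ω ^ 4 ∂μ := integral_nonneg fun ω => by positivity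
  have hT0 : 0 ≤ ∫ ω, T ω ^ 4 ∂μ := integral_nonneg fun ω => by positivity
  rw [Real.sqrt_le_left (by positivity)]
  nlinarith [Real.sq_sqrt hY0, Real.sq_sqrt hT0, Real.sqrt_nonneg (∫ ω, T ω ^ 4 ∂μ)]

end Residual

/-! ### Gaussian integrals -/

section Gaussian

lemma hasDerivAt_neg_sq_div_two (x : ℝ) : HasDerivAt (fun x : ℝ => -x ^ 2 / 2) (-x) x :=
  ((hasDerivAt_pow 2 x).fun_neg.div_const 2).congr_deriv (by norm_num; ring)

lemma tendsto_exp_neg_sq_div_two : Tendsto (fun x : ℝ => Real.exp (-x ^ 2 / 2)) atTop (𝓝 0) := by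
  refine Real.tendsto_exp_atBot.comp ?_
  simp_rw [neg_div]
  exact tendsto_neg_atTop_atBot.comp ((tendsto_pow_atTop two_ne_zero).atTop_div_const two_pos)

lemma hasDerivAt_gaussianPDFReal_zero_one (x : ℝ) :
    HasDerivAt (gaussianPDFReal 0 1) (-(x * gaussianPDFReal 0 1 x)) x := by
  have := (hasDerivAt_neg_sq_div_two x).exp.const_mul (√(2 * Real.pi))⁻¹
  have e : gaussianPDFReal 0 1 = fun x => (√(2 * Real.pi))⁻¹ * Real.exp (-x ^ 2 / 2) := by
    ext x; simp [gaussianPDFReal]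
  rw [e]
  exact this.congr_deriv (by ring)

lemma integrable_id_mul_gaussianPDFReal :
    Integrable (fun x : ℝ => x * gaussianPDFReal 0 1 x) := by
  refine ((integrable_mul_exp_neg_mul_sq (b := 1 / 2) (by norm_num)).const_mul
    (√(2 * Real.pi))⁻¹).congr (.of_forall fun x => ?_)
  simp only [gaussianPDFReal]
  simp only [NNReal.coe_one, mul_one, sub_zero]
  rw [show -(1 / 2) * x ^ 2 = -x ^ 2 / 2 by ring]
  ring

lemma integral_abs_gaussianReal : ∫ x, |x| ∂(gaussianReal 0 1) = √(2 / Real.pi) := by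
  rw [integral_gaussianReal_eq_integral_smul one_ne_zero]
  have e : ∀ x : ℝ, gaussianPDFReal 0 1 x • |x| = (fun y => y * gaussianPDFReal 0 1 y) |x| := by
    intro x; simp [gaussianPDFReal, mul_comm]
  simp_rw [e]
  rw [integral_comp_abs (f := fun y => y * gaussianPDFReal 0 1 y)]
  have hlim : Tendsto (fun x => -gaussianPDFReal 0 1 x) atTop (𝓝 0) := by
    have h2 := (tendsto_exp_neg_sq_div_two.const_mul (-(√(2 * Real.pi))⁻¹))
    rw [mul_zero] at h2
    refine h2.congr fun x => ?_
    simp [gaussianPDFReal]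
  rw [integral_Ioi_of_hasDerivAt_of_tendsto' (f := fun x => -gaussianPDFReal 0 1 x) (m := 0)
    (fun x _ => (hasDerivAt_gaussianPDFReal_zero_one x).fun_neg.congr_deriv (neg_neg _))
    integrable_id_mul_gaussianPDFReal.integrableOn hlim]
  simp only [gaussianPDFReal]
  rw [Real.sqrt_div (by norm_num)]
  simp
  have h2 : √2 * √2 = 2 := Real.mul_self_sqrt (by norm_num)
  field_simp
  linarith

/-- Gaussian integration by parts. -/
lemma integral_mul_gaussianReal_eq_integral_deriv {ψ ψ' : ℝ → ℝ} {a b : ℝ}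
    (hψ : ∀ x, HasDerivAt ψ (ψ' x) x) (hψ' : Continuous ψ') (ha : ∀ x, |ψ x| ≤ a)
    (hb : ∀ x, |ψ' x| ≤ b) :
    ∫ x, x * ψ x ∂(gaussianReal 0 1) = ∫ x, ψ' x ∂(gaussianReal 0 1) := by
  have hψc : Continuous ψ := continuous_iff_continuousAt.2 fun x => (hψ x).continuousAt
  have i1 : Integrable (ψ * fun x => -(x * gaussianPDFReal 0 1 x)) :=
    integrable_id_mul_gaussianPDFReal.neg.bdd_mul (c := a) hψc.aestronglyMeasurable
      (.of_forall fun x => ha x)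
  have i2 : Integrable (ψ' * gaussianPDFReal 0 1) :=
    (integrable_gaussianPDFReal 0 1).bdd_mul (c := b) hψ'.aestronglyMeasurable
      (.of_forall fun x => hb x)
  have i3 : Integrable (ψ * gaussianPDFReal 0 1) :=
    (integrable_gaussianPDFReal 0 1).bdd_mul (c := a) hψc.aestronglyMeasurable
      (.of_forall fun x => ha x)
  have h := integral_mul_deriv_eq_deriv_mul_of_integrable (fun x _ => hψ x)
    (fun x _ => hasDerivAt_gaussianPDFReal_zero_one x) i1 i2 i3
  rw [integral_gaussianReal_eq_integral_smul one_ne_zero,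
    integral_gaussianReal_eq_integral_smul one_ne_zero]
  simp only [mul_neg, integral_neg, neg_inj, smul_eq_mul] at h ⊢
  simp only [mul_comm (gaussianPDFReal 0 1 _)]
  rw [← h]
  congr 1; ext x; ring

end Gaussian

/-! ### Stein's equation -/

section Stein

/-- Bounded solutions of `g' = x g + k` satisfy `x g x ≤ sup |k|` on the positive half-line: the
function `t ↦ (g t - K / x) exp (-t² / 2)` increases on `[x, ∞)` and tends to zero. -/
lemma mul_le_of_hasDerivAt_of_pos {g k : ℝ → ℝ} {c K : ℝ}
    (hg : ∀ x, HasDerivAt g (x * g x + k x) x) (hc : ∀ x, |g x| ≤ c) (hK : ∀ x, |k x| ≤ K)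
    {x : ℝ} (hx : 0 < x) : x * g x ≤ K := by
  have hK0 : 0 ≤ K := (abs_nonneg _).trans (hK 0)
  set Φ : ℝ → ℝ := fun t => (g t - K / x) * Real.exp (-t ^ 2 / 2)
  have hder : ∀ t, HasDerivAt Φ ((k t + K * t / x) * Real.exp (-t ^ 2 / 2)) t := fun t =>
    (((hg t).sub_const (K / x)).mul (hasDerivAt_neg_sq_div_two t).exp).congr_deriv (by ring)
  have hmono : MonotoneOn Φ (Set.Ici x) := by
    refine monotoneOn_of_deriv_nonneg (convex_Ici x)
      (fun t _ => (hder t).continuousAt.continuousWithinAt)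
      (fun t _ => (hder t).differentiableAt.differentiableWithinAt) fun t ht => ?_
    rw [interior_Ici] at ht
    rw [(hder t).deriv]
    have h1 : K ≤ K * t / x := by
      rw [le_div_iff₀ hx]; exact mul_le_mul_of_nonneg_left (le_of_lt ht) hK0
    have h2 := (abs_le.1 (hK t)).1
    exact mul_nonneg (by linarith) (Real.exp_pos _).le
  have hlim : Tendsto Φ atTop (𝓝 0) := by
    refine bdd_le_mul_tendsto_zero' (c + K / x) (.of_forall fun t => ?_)
      tendsto_exp_neg_sq_div_two
    refine (abs_sub _ _).trans (add_le_add (hc t) (le_of_eq (abs_of_nonneg (by positivity))))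
  have h0 : Φ x ≤ 0 := ge_of_tendsto hlim <| by
    filter_upwards [eventually_ge_atTop x] with t ht using hmono Set.self_mem_Ici ht ht
  have h1 : g x - K / x ≤ 0 := nonpos_of_mul_nonpos_left h0 (Real.exp_pos _)
  rw [sub_nonpos, le_div_iff₀ hx] at h1
  linarith

lemma abs_mul_le_of_hasDerivAt {g k : ℝ → ℝ} {c K : ℝ}
    (hg : ∀ x, HasDerivAt g (x * g x + k x) x) (hc : ∀ x, |g x| ≤ c) (hK : ∀ x, |k x| ≤ K)
    (x : ℝ) : |x * g x| ≤ K := by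
  have hpos : ∀ {g k : ℝ → ℝ}, (∀ x, HasDerivAt g (x * g x + k x) x) → (∀ x, |g x| ≤ c) →
      (∀ x, |k x| ≤ K) → ∀ {x : ℝ}, 0 < x → |x * g x| ≤ K := by
    intro g k hg hc hK x hx
    refine abs_le'.2 ⟨mul_le_of_hasDerivAt_of_pos hg hc hK hx, ?_⟩
    have := mul_le_of_hasDerivAt_of_pos (g := fun x => -g x) (k := fun x => -k x) (c := c)
      (K := K) (fun x => (hg x).neg.congr_deriv (by ring)) (by simpa using hc)
      (by simpa using hK) hx
    linarith
  rcases lt_trichotomy x 0 with hx | rfl | hx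
  · have h := hpos (g := fun x => g (-x)) (k := fun x => -k (-x))
      (fun x => ((hg (-x)).scomp x (hasDerivAt_neg x)).congr_deriv (by simp; ring))
      (fun x => hc _) (fun x => by simpa using hK (-x)) (neg_pos.2 hx)
    simpa using h
  · simpa using (abs_nonneg _).trans (hK 0)
  · exact hpos hg hc hK hx

/-- The product of Lebesgue measure on `(0, π/2]` and of the standard Gaussian law; integrating
along `θ ↦ cos θ • x + sin θ • n` interpolates between `x` and a Gaussian variable `n`. -/
noncomputable def angleGaussian : Measure (ℝ × ℝ) :=
  (volume.restrict (Set.Ioc 0 (Real.pi / 2))).prod (gaussianReal 0 1)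

instance : IsFiniteMeasure angleGaussian := by unfold angleGaussian; infer_instance

lemma integrable_snd_angleGaussian : Integrable (fun z : ℝ × ℝ => z.2) angleGaussian := by
  have h : Integrable (fun x : ℝ => x) (gaussianReal 0 1) :=
    (memLp_id_gaussianReal' 1 (by simp)).integrable le_rfl
  exact h.comp_snd _

lemma integrable_angleGaussian_of_abs_le {F : ℝ × ℝ → ℝ} (hF : Continuous F) {a b : ℝ}
    (h : ∀ z, |F z| ≤ a + b * |z.2|) : Integrable F angleGaussian :=
  ((integrable_const a).add (integrable_snd_angleGaussian.abs.const_mul b)).mono'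
    hF.aestronglyMeasurable (.of_forall h)

lemma integral_angleGaussian {F : ℝ × ℝ → ℝ} (hF : Integrable F angleGaussian) :
    ∫ z, F z ∂angleGaussian
      = ∫ θ in Set.Ioc 0 (Real.pi / 2), ∫ n, F (θ, n) ∂(gaussianReal 0 1) := integral_prod _ hF

lemma integral_angleGaussian_swap {F : ℝ × ℝ → ℝ} (hF : Integrable F angleGaussian) :
    ∫ z, F z ∂angleGaussian
      = ∫ n, (∫ θ in (0)..(Real.pi / 2), F (θ, n)) ∂(gaussianReal 0 1) := by
  simp_rw [intervalIntegral.integral_of_le (by positivity : (0 : ℝ) ≤ Real.pi / 2)]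
  rw [angleGaussian] at hF ⊢
  rw [integral_prod_symm _ hF]

lemma sin_nonneg_and_cos_nonneg_ae_angleGaussian :
    ∀ᵐ z ∂angleGaussian, 0 ≤ Real.sin z.1 ∧ 0 ≤ Real.cos z.1 := by
  have h : ∀ᵐ θ ∂(volume.restrict (Set.Ioc 0 (Real.pi / 2))), 0 ≤ Real.sin θ ∧ 0 ≤ Real.cos θ := by
    filter_upwards [ae_restrict_mem measurableSet_Ioc] with θ hθ
    have := Real.pi_pos
    exact ⟨Real.sin_nonneg_of_nonneg_of_le_pi hθ.1.le (by linarith [hθ.2]),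
      Real.cos_nonneg_of_mem_Icc ⟨by linarith [hθ.1], hθ.2⟩⟩
  exact Measure.quasiMeasurePreserving_fst.ae h

lemma integral_sin_angleGaussian : ∫ z, Real.sin z.1 ∂angleGaussian = 1 := by
  have h := integral_prod_mul (μ := volume.restrict (Set.Ioc 0 (Real.pi / 2)))
    (ν := gaussianReal 0 1) Real.sin (fun _ => (1 : ℝ))
  simp only [mul_one] at h
  rw [angleGaussian, h, ← intervalIntegral.integral_of_le (by positivity)]
  simp

lemma integral_cos_mul_abs_angleGaussian :
    ∫ z, Real.cos z.1 * |z.2| ∂angleGaussian = √(2 / Real.pi) := by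
  rw [angleGaussian, integral_prod_mul (μ := volume.restrict (Set.Ioc 0 (Real.pi / 2)))
    (ν := gaussianReal 0 1) Real.cos (fun n => |n|), integral_abs_gaussianReal,
    ← intervalIntegral.integral_of_le (by positivity)]
  simp

/-- For a test function `h` with derivative bounded by one, Stein's equation
`f' x = x f x + h x - E h(N)` has a bounded solution with `|f'| ≤ √(2/π)` and with `f'`
Lipschitz. It is `f x = - ∫ sin θ E[h'(cos θ x + sin θ N)] dθ` over `(0, π/2)`. -/
theorem exists_stein_solution {h h' h'' : ℝ → ℝ} {b : ℝ} (hh : ∀ x, HasDerivAt h (h' x) x)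
    (hh' : ∀ x, HasDerivAt h' (h'' x) x) (hh'' : Continuous h'') (hb : ∀ x, |h' x| ≤ 1)
    (hb' : ∀ x, |h'' x| ≤ b) :
    ∃ f f' : ℝ → ℝ, (∀ x, HasDerivAt f (f' x) x) ∧
      (∀ x, f' x = x * f x + (h x - ∫ n, h n ∂(gaussianReal 0 1))) ∧ (∀ x, |f x| ≤ 1) ∧
      (∀ x, |f' x| ≤ √(2 / Real.pi)) ∧ ∀ x y, |f' x - f' y| ≤ 4 * |x - y| := by
  have hc' : Continuous h' := continuous_iff_continuousAt.2 fun x => (hh' x).continuousAt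
  have hb0 : 0 ≤ b := (abs_nonneg _).trans (hb' 0)
  set pt : ℝ → ℝ × ℝ → ℝ := fun x z => Real.cos z.1 * x + Real.sin z.1 * z.2 with hpt
  have c1 : ∀ x, Continuous fun z : ℝ × ℝ => Real.sin z.1 * h' (pt x z) := fun x => by fun_prop
  have c2 : ∀ x, Continuous fun z : ℝ × ℝ => Real.sin z.1 * (h'' (pt x z) * Real.cos z.1) :=
    fun x => by fun_prop
  have c3 : ∀ x, Continuous fun z : ℝ × ℝ => Real.cos z.1 * (z.2 * h' (pt x z)) :=
    fun x => by fun_prop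
  have b1 : ∀ x z, |Real.sin z.1 * h' (pt x z)| ≤ 1 + 0 * |z.2| := fun x z => by
    rw [abs_mul, zero_mul, add_zero]
    exact mul_le_one₀ (Real.abs_sin_le_one _) (abs_nonneg _) (hb _)
  have b2 : ∀ x z, |Real.sin z.1 * (h'' (pt x z) * Real.cos z.1)| ≤ b + 0 * |z.2| := fun x z => by
    rw [abs_mul, abs_mul, zero_mul, add_zero]
    calc _ ≤ 1 * (b * 1) := by
          gcongr
          exacts [Real.abs_sin_le_one _, hb' _, Real.abs_cos_le_one _]
      _ = b := by ring
  have b3 : ∀ x z, |Real.cos z.1 * (z.2 * h' (pt x z))| ≤ 0 + 1 * |z.2| := fun x z => by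
    rw [abs_mul, abs_mul]
    calc _ ≤ 1 * (|z.2| * 1) := by
          gcongr
          exacts [Real.abs_cos_le_one _, hb _]
      _ = _ := by ring
  have i1 := fun x => integrable_angleGaussian_of_abs_le (c1 x) (b1 x)
  have i2 := fun x => integrable_angleGaussian_of_abs_le (c2 x) (b2 x)
  have i3 := fun x => integrable_angleGaussian_of_abs_le (c3 x) (b3 x)
  set f : ℝ → ℝ := fun x => -∫ z, Real.sin z.1 * h' (pt x z) ∂angleGaussian with hf
  set f' : ℝ → ℝ := fun x => -∫ z, Real.cos z.1 * (z.2 * h' (pt x z)) ∂angleGaussian with hf'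
  have parts : ∀ x, ∫ z, Real.sin z.1 * (h'' (pt x z) * Real.cos z.1) ∂angleGaussian
      = ∫ z, Real.cos z.1 * (z.2 * h' (pt x z)) ∂angleGaussian := fun x => by
    rw [integral_angleGaussian (i2 x), integral_angleGaussian (i3 x)]
    congr 1; ext θ
    simp only
    rw [integral_const_mul (Real.cos θ), integral_mul_gaussianReal_eq_integral_deriv
      (ψ := fun n => h' (pt x (θ, n))) (ψ' := fun n => h'' (pt x (θ, n)) * Real.sin θ)
      (a := 1) (b := b), ← integral_const_mul]
    · congr 1; ext n; ring
    · intro n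
      refine (hh' _).comp n ?_
      simpa [hpt] using ((hasDerivAt_id n).const_mul (Real.sin θ)).const_add (Real.cos θ * x)
    · fun_prop
    · exact fun n => hb _
    · intro n
      rw [abs_mul]
      calc _ ≤ b * 1 := by gcongr; exacts [hb' _, Real.abs_sin_le_one _]
        _ = b := mul_one b
  have hder : ∀ x, HasDerivAt f (f' x) x := fun x => by
    have := (hasDerivAt_integral_of_dominated_loc_of_deriv_le (μ := angleGaussian)
      (F := fun x z => Real.sin z.1 * h' (pt x z))
      (F' := fun x z => Real.sin z.1 * (h'' (pt x z) * Real.cos z.1)) (bound := fun _ => b)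
      (x₀ := x) (s := Set.univ) univ_mem (.of_forall fun y => (c1 y).aestronglyMeasurable) (i1 x)
      (c2 x).aestronglyMeasurable (.of_forall fun z y _ => by simpa using b2 y z)
      (integrable_const b) (.of_forall fun z y _ => by
        refine HasDerivAt.const_mul _ ((hh' _).comp y ?_)
        simpa [hpt] using ((hasDerivAt_id y).const_mul (Real.cos z.1)).add_const
          (Real.sin z.1 * z.2))).2
    rw [parts] at this
    exact this.neg
  have heq : ∀ x, f' x = x * f x + (h x - ∫ n, h n ∂(gaussianReal 0 1)) := fun x => by
    have i4 : Integrable (fun z : ℝ × ℝ => Real.cos z.1 * (z.2 * h' (pt x z))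
        - x * (Real.sin z.1 * h' (pt x z))) angleGaussian := (i3 x).sub' ((i1 x).const_mul x)
    have hin : Integrable h (gaussianReal 0 1) := by
      have hl : Integrable (fun n : ℝ => |h 0| + |n|) (gaussianReal 0 1) :=
        (integrable_const _).add
          ((memLp_id_gaussianReal' (μ := 0) (v := 1) 1 (by simp)).integrable le_rfl).abs
      have hc : Continuous h := continuous_iff_continuousAt.2 fun x => (hh x).continuousAt
      refine hl.mono' hc.aestronglyMeasurable (.of_forall fun n => ?_)
      have := convex_univ.norm_image_sub_le_of_norm_hasDerivWithin_le
        (f := h) (f' := h') (C := 1) (fun t _ => (hh t).hasDerivWithinAt)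
        (fun t _ => hb t) (Set.mem_univ 0) (Set.mem_univ n)
      have h3 := norm_sub_norm_le (h n) (h 0)
      simp only [Real.norm_eq_abs, sub_zero, one_mul] at this h3 ⊢
      linarith
    have h1 : ∫ z, (Real.cos z.1 * (z.2 * h' (pt x z)) - x * (Real.sin z.1 * h' (pt x z)))
        ∂angleGaussian = ∫ n, h n ∂(gaussianReal 0 1) - h x := by
      rw [integral_angleGaussian_swap i4]
      have : ∀ n : ℝ, ∫ θ in (0)..(Real.pi / 2), (Real.cos θ * (n * h' (pt x (θ, n)))
          - x * (Real.sin θ * h' (pt x (θ, n)))) = h n - h x := fun n => by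
        have h2 := intervalIntegral.integral_eq_sub_of_hasDerivAt (a := 0) (b := Real.pi / 2)
          (f := fun θ => h (pt x (θ, n)))
          (f' := fun θ => Real.cos θ * (n * h' (pt x (θ, n)))
            - x * (Real.sin θ * h' (pt x (θ, n)))) (fun θ _ => by
            have hp : HasDerivAt (fun θ => pt x (θ, n)) (-Real.sin θ * x + Real.cos θ * n) θ :=
              ((Real.hasDerivAt_cos θ).mul_const x).add ((Real.hasDerivAt_sin θ).mul_const n)
            exact ((hh _).comp θ hp).congr_deriv (by ring))
          (Continuous.intervalIntegrable (by fun_prop) _ _)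
        rw [h2]; simp [hpt]
      simp_rw [this]
      rw [integral_sub hin (integrable_const _)]
      simp
    rw [integral_sub (i3 x) ((i1 x).const_mul x), integral_const_mul] at h1
    simp only [hf, hf']
    linarith
  have hf1 : ∀ x, |f x| ≤ 1 := fun x => by
    simp only [hf]
    rw [abs_neg, ← integral_sin_angleGaussian, ← Real.norm_eq_abs]
    refine norm_integral_le_of_norm_le (integrable_angleGaussian_of_abs_le (a := 1) (b := 0)
      (by fun_prop) fun z => by simpa using Real.abs_sin_le_one _) ?_
    filter_upwards [sin_nonneg_and_cos_nonneg_ae_angleGaussian] with z hz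
    rw [Real.norm_eq_abs, abs_mul, abs_of_nonneg hz.1]
    exact mul_le_of_le_one_right hz.1 (hb _)
  have hf2 : ∀ x, |f' x| ≤ √(2 / Real.pi) := fun x => by
    simp only [hf']
    rw [abs_neg, ← integral_cos_mul_abs_angleGaussian, ← Real.norm_eq_abs]
    refine norm_integral_le_of_norm_le (integrable_angleGaussian_of_abs_le (a := 0) (b := 1)
      (by fun_prop) fun z => ?_) ?_
    · rw [abs_mul, abs_abs, zero_add]
      gcongr; exact Real.abs_cos_le_one _
    filter_upwards [sin_nonneg_and_cos_nonneg_ae_angleGaussian] with z hz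
    rw [Real.norm_eq_abs, abs_mul, abs_of_nonneg hz.2, abs_mul]
    exact mul_le_mul_of_nonneg_left (mul_le_of_le_one_right (abs_nonneg _) (hb _)) hz.2
  refine ⟨f, f', hder, heq, hf1, hf2, fun x y => ?_⟩
  -- `f'` solves Stein's equation with the right-hand side `f + h'`, which is bounded by `2`, so
  -- that `|f''| ≤ |x f'| + |f + h'| ≤ 4`
  have hder' : ∀ x, HasDerivAt f' (x * f' x + (f x + h' x)) x := fun x => by
    have := ((hasDerivAt_id x).mul (hder x)).add ((hh x).sub_const (∫ n, h n ∂(gaussianReal 0 1)))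
    refine (this.congr_of_eventuallyEq (.of_forall fun y => ?_)).congr_deriv ?_
    · simpa using heq y
    · simp only [id_eq]; ring
  have hk : ∀ x, |f x + h' x| ≤ 2 := fun x =>
    (abs_add_le _ _).trans (by linarith [hf1 x, hb x])
  have h4 := convex_univ.norm_image_sub_le_of_norm_hasDerivWithin_le
    (f := f') (f' := fun x => x * f' x + (f x + h' x)) (C := 4)
    (fun t _ => (hder' t).hasDerivWithinAt)
    (fun t _ => (abs_add_le _ _).trans
      (by linarith [abs_mul_le_of_hasDerivAt hder' hf2 hk t, hk t]))
    (Set.mem_univ y) (Set.mem_univ x)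
  simpa using h4

end Stein

/-! ### Smoothing of Lipschitz test functions -/

section Smoothing

/-- The moving average `ε⁻¹ ∫ h` over `[x, x + ε]`. -/
noncomputable def movingAverage (ε : ℝ) (h : ℝ → ℝ) (x : ℝ) : ℝ := ε⁻¹ * ∫ y in x..(x + ε), h y

lemma hasDerivAt_movingAverage {ε : ℝ} {h : ℝ → ℝ} (hh : Continuous h) (x : ℝ) :
    HasDerivAt (movingAverage ε h) (ε⁻¹ * (h (x + ε) - h x)) x := by
  have e : movingAverage ε h = fun x =>
      ε⁻¹ * ((∫ y in (0)..(x + ε), h y) - ∫ y in (0)..x, h y) := by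
    ext x
    rw [movingAverage, intervalIntegral.integral_interval_sub_left (hh.intervalIntegrable _ _)
      (hh.intervalIntegrable _ _)]
  rw [e]
  have h1 : ∀ x, HasDerivAt (fun x => ∫ y in (0)..x, h y) (h x) x := fun x =>
    intervalIntegral.integral_hasDerivAt_right (hh.intervalIntegrable _ _)
      (hh.stronglyMeasurableAtFilter _ _) hh.continuousAt
  exact (((h1 (x + ε)).comp_add_const x ε).sub (h1 x)).const_mul ε⁻¹

lemma abs_movingAverage_sub_le {ε : ℝ} (hε : 0 < ε) {h : ℝ → ℝ} (hh : LipschitzWith 1 h) (x : ℝ) :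
    |movingAverage ε h x - h x| ≤ ε := by
  have e : movingAverage ε h x - h x = ε⁻¹ * ∫ y in x..(x + ε), (h y - h x) := by
    rw [intervalIntegral.integral_sub (hh.continuous.intervalIntegrable _ _)
      (intervalIntegrable_const)]
    simp [movingAverage]; field_simp
  rw [e, abs_mul, abs_of_pos (inv_pos.2 hε), inv_mul_le_iff₀ hε]
  have := intervalIntegral.norm_integral_le_of_norm_le_const (a := x) (b := x + ε) (C := ε)
    (f := fun y => h y - h x) fun y hy => by
      rw [Set.uIoc_of_le (by linarith)] at hy
      have := hh.dist_le_mul y x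
      rw [Real.dist_eq, Real.dist_eq, abs_of_pos (sub_pos.2 hy.1)] at this
      rw [Real.norm_eq_abs]
      simp only [NNReal.coe_one, one_mul] at this
      linarith [hy.2]
  simpa [abs_of_pos hε] using this

lemma abs_inv_mul_sub_le_one {ε : ℝ} (hε : 0 < ε) {h : ℝ → ℝ} (hh : LipschitzWith 1 h) (x : ℝ) :
    |ε⁻¹ * (h (x + ε) - h x)| ≤ 1 := by
  have := hh.dist_le_mul (x + ε) x
  rw [Real.dist_eq, Real.dist_eq] at this
  rw [abs_mul, abs_of_pos (inv_pos.2 hε), inv_mul_le_iff₀ hε]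
  simpa [abs_of_pos hε] using this

lemma lipschitzWith_movingAverage {ε : ℝ} (hε : 0 < ε) {h : ℝ → ℝ} (hh : LipschitzWith 1 h) :
    LipschitzWith 1 (movingAverage ε h) :=
  LipschitzWith.of_dist_le_mul fun x y => by
    have := convex_univ.norm_image_sub_le_of_norm_hasDerivWithin_le
      (f := movingAverage ε h) (C := 1)
      (fun t _ => (hasDerivAt_movingAverage (ε := ε) hh.continuous t).hasDerivWithinAt)
      (fun t _ => abs_inv_mul_sub_le_one hε hh t) (Set.mem_univ y) (Set.mem_univ x)
    simpa [Real.dist_eq] using this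

/-- It suffices to bound `|∫ h dν - ∫ h dγ|` for test functions with two derivatives. -/
lemma wassersteinDist_le_of_smooth {ν₁ ν₂ : Measure ℝ} [IsProbabilityMeasure ν₁]
    [IsProbabilityMeasure ν₂] (h₁ : Integrable (fun x : ℝ => x) ν₁)
    (h₂ : Integrable (fun x : ℝ => x) ν₂) {B : ℝ}
    (H : ∀ (h h' h'' : ℝ → ℝ) (b : ℝ), (∀ x, HasDerivAt h (h' x) x) →
      (∀ x, HasDerivAt h' (h'' x) x) → Continuous h'' → (∀ x, |h' x| ≤ 1) → (∀ x, |h'' x| ≤ b) →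
      |∫ x, h x ∂ν₁ - ∫ x, h x ∂ν₂| ≤ B) :
    wassersteinDist ν₁ ν₂ ≤ ENNReal.ofReal B := by
  refine iSup₂_le fun h hh => ENNReal.ofReal_le_ofReal (le_of_forall_pos_le_add fun δ hδ => ?_)
  have hε : 0 < δ / 4 := by positivity
  set ε := δ / 4 with hεd
  set g := movingAverage ε h
  have hg : LipschitzWith 1 g := lipschitzWith_movingAverage hε hh
  set k := movingAverage ε g
  have hk : LipschitzWith 1 k := lipschitzWith_movingAverage hε hg
  have d1 := fun x => hasDerivAt_movingAverage (ε := ε) hh.continuous x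
  have d2 := fun x => hasDerivAt_movingAverage (ε := ε) hg.continuous x
  have hc := hh.continuous
  have key := H k _ (fun x => ε⁻¹ * (ε⁻¹ * (h (x + ε + ε) - h (x + ε)) - ε⁻¹ * (h (x + ε) - h x)))
    (ε⁻¹ * 2) d2 (fun x => (((d1 (x + ε)).comp_add_const x ε).sub (d1 x)).const_mul ε⁻¹)
    (by fun_prop) (abs_inv_mul_sub_le_one hε hg) (fun x => by
      rw [abs_mul, abs_of_pos (inv_pos.2 hε)]
      gcongr
      refine (abs_sub _ _).trans ?_
      linarith [abs_inv_mul_sub_le_one hε hh x, abs_inv_mul_sub_le_one hε hh (x + ε)])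
  have int : ∀ (ν : Measure ℝ) [IsProbabilityMeasure ν], Integrable (fun x : ℝ => x) ν →
      ∀ {f : ℝ → ℝ}, LipschitzWith 1 f → Integrable f ν := fun ν _ hν f hf => by
    refine ((integrable_const |f 0|).add hν.abs).mono' hf.continuous.aestronglyMeasurable
      (.of_forall fun x => ?_)
    have h1 := hf.dist_le_mul x 0
    have h2 := norm_sub_norm_le (f x) (f 0)
    simp only [Real.dist_eq, Real.norm_eq_abs, NNReal.coe_one, one_mul, sub_zero,
      Pi.add_apply] at h1 h2 ⊢
    linarith
  have app : ∀ (ν : Measure ℝ) [IsProbabilityMeasure ν], Integrable (fun x : ℝ => x) ν →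
      |∫ x, h x ∂ν - ∫ x, k x ∂ν| ≤ ε + ε := fun ν _ hν => by
    rw [← integral_sub (int ν hν hh) (int ν hν hk)]
    have := norm_integral_le_of_norm_le_const (μ := ν) (f := fun x => h x - k x) (C := ε + ε)
      (.of_forall fun x => by
        have h1 := abs_movingAverage_sub_le hε hh x
        have h2 := abs_movingAverage_sub_le hε hg x
        rw [Real.norm_eq_abs, abs_sub_comm]
        calc |k x - h x| ≤ |k x - g x| + |g x - h x| := abs_sub_le _ _ _
          _ ≤ ε + ε := add_le_add h2 h1)
    simpa using this
  have a1 := abs_le.1 (app ν₁ h₁)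
  have a2 := abs_le.1 (app ν₂ h₂)
  have a3 := abs_le.1 key
  rw [abs_le]
  constructor <;> linarith

end Smoothing

/-! ### Chaos expansions -/

section ChaosExpansion

variable {Ω A E₀ : Type*} {E : A → Type*} [MeasurableSpace E₀] [∀ a, MeasurableSpace (E a)]
  {Z : Ω → E₀} {X : ∀ a, Ω → E a}

lemma condSigma_mono {K L : Set A} (h : K ⊆ L) : condSigma Z X K ≤ condSigma Z X L :=
  sup_le_sup_right (biSup_mono fun _ ha => h ha) _

variable {mΩ : MeasurableSpace Ω}

lemma condSigma_le (hZ : Measurable Z) (hX : ∀ a, Measurable (X a)) (K : Set A) :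
    condSigma Z X K ≤ mΩ :=
  sup_le (iSup₂_le fun a _ => (hX a).comap_le) hZ.comap_le

/-- The residual `D_a f = f - E[f | 𝒢_{A ∖ {a}}]` with respect to the coordinate `a`. -/
noncomputable abbrev coordResidual (μ : Measure Ω) (Z : Ω → E₀) (X : ∀ a, Ω → E a) (a : A)
    (f : Ω → ℝ) : Ω → ℝ := condResidual (condSigma Z X {a}ᶜ) μ f

variable {μ : Measure Ω}

lemma sqrt_integral_sq_eq_eLpNorm {g : Ω → ℝ} (hg : MemLp g 2 μ) :
    √(∫ ω, g ω ^ 2 ∂μ) = (eLpNorm g 2 μ).toReal := by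
  rw [hg.eLpNorm_eq_integral_rpow_norm two_ne_zero (by simp), ENNReal.toReal_ofReal (by positivity),
    Real.sqrt_eq_rpow]
  simp

lemma tendsto_integral_mul_of_tendsto_eLpNorm {ι : Type*} {l : Filter ι} {f : ι → Ω → ℝ}
    {g φ : Ω → ℝ} (hf : ∀ i, MemLp (f i) 2 μ) (hg : MemLp g 2 μ) (hφ : MemLp φ 2 μ)
    (h : Tendsto (fun i => eLpNorm (fun ω => g ω - f i ω) 2 μ) l (𝓝 0)) :
    Tendsto (fun i => ∫ ω, f i ω * φ ω ∂μ) l (𝓝 (∫ ω, g ω * φ ω ∂μ)) := by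
  have h1 : Tendsto (fun i => (eLpNorm (fun ω => g ω - f i ω) 2 μ).toReal
      * √(∫ ω, φ ω ^ 2 ∂μ)) l (𝓝 0) := by
    simpa using ((ENNReal.tendsto_toReal ENNReal.zero_ne_top).comp h).mul_const _
  rw [tendsto_iff_dist_tendsto_zero]
  refine squeeze_zero (fun _ => dist_nonneg) (fun i => ?_) h1
  have hs : √(∫ ω, (g ω - f i ω) ^ 2 ∂μ) = (eLpNorm (fun ω => g ω - f i ω) 2 μ).toReal :=
    sqrt_integral_sq_eq_eLpNorm (hg.sub (hf i))
  rw [← hs, Real.dist_eq, abs_sub_comm,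
    ← integral_sub (hg.integrable_mul_two hφ) ((hf i).integrable_mul_two hφ)]
  simp only [← sub_mul]
  exact abs_integral_mul_le (hg.sub (hf i)) hφ

namespace IsDegenerateUStatistic

variable {k l : ℕ} {W V : Finset A → Ω → ℝ} {F G φ : Ω → ℝ}

lemma coordResidual_of_mem (hU : IsDegenerateUStatistic μ Z X k W F) {J : Finset A}
    (hJ : J.card = k) {a : A} (ha : a ∈ J) : coordResidual μ Z X a (W J) =ᵐ[μ] W J := by
  filter_upwards [hU.condExp_component J hJ {a}ᶜ fun h => h ha rfl] with ω h
  simp [coordResidual, condResidual, h]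

lemma aestronglyMeasurable_of_notMem (hU : IsDegenerateUStatistic μ Z X k W F) {J : Finset A}
    (hJ : J.card = k) {a : A} (ha : a ∉ J) :
    AEStronglyMeasurable[condSigma Z X {a}ᶜ] (W J) μ :=
  (hU.measurable_component J hJ).mono (condSigma_mono fun b hb hba => ha (by
    rw [Set.mem_singleton_iff] at hba; exact hba ▸ hb))

lemma hasSum_integral_component_mul (hU : IsDegenerateUStatistic μ Z X k W F)
    (hφ : MemLp φ 2 μ) :
    HasSum (fun J : {J : Finset A // J.card = k} => ∫ ω, W J.1 ω * φ ω ∂μ)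
      (∫ ω, F ω * φ ω ∂μ) := by
  have h := tendsto_integral_mul_of_tendsto_eLpNorm
    (fun S => memLp_finsetSum S fun J _ => hU.memLp_component J.1 J.2) hU.memLp_two hφ
    hU.tendsto_sum
  refine h.congr fun S => ?_
  simp only [Finset.sum_mul]
  exact integral_finsetSum S fun J _ => (hU.memLp_component J.1 J.2).integrable_mul_two hφ

variable [IsProbabilityMeasure μ]

lemma coordResidual_of_notMem (hG : ∀ K, condSigma Z X K ≤ mΩ)
    (hU : IsDegenerateUStatistic μ Z X k W F) {J : Finset A}
    (hJ : J.card = k) {a : A} (ha : a ∉ J) : coordResidual μ Z X a (W J) =ᵐ[μ] 0 := by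
  filter_upwards [condExp_of_aestronglyMeasurable' (hG {a}ᶜ)
    (hU.aestronglyMeasurable_of_notMem hJ ha)
    ((hU.memLp_component J hJ).integrable one_le_two)] with ω h
  simp [coordResidual, condResidual, h]

open Classical in
lemma hasSum_integral_component_mul_ite (hG : ∀ K, condSigma Z X K ≤ mΩ)
    (hU : IsDegenerateUStatistic μ Z X k W F) (hφ : MemLp φ 2 μ) (a : A) :
    HasSum (fun J : {J : Finset A // J.card = k} =>
      if a ∈ J.1 then ∫ ω, W J.1 ω * φ ω ∂μ else 0) (∫ ω, coordResidual μ Z X a F ω * φ ω ∂μ) := by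
  have h := hU.hasSum_integral_component_mul
    (hφ.condResidual (m := condSigma Z X {a}ᶜ) one_le_two)
  rw [← integral_condResidual_mul_comm (hG _) hU.memLp_two hφ] at h
  convert h using 2 with J
  rw [← integral_condResidual_mul_comm (hG _) (hU.memLp_component J.1 J.2) hφ]
  split_ifs with ha
  · refine integral_congr_ae ?_
    filter_upwards [hU.coordResidual_of_mem J.2 ha] with ω h
    rw [← h]
  · refine (integral_eq_zero_of_ae ?_).symm
    filter_upwards [hU.coordResidual_of_notMem hG J.2 ha] with ω h
    change coordResidual μ Z X a (W J.1) ω * φ ω = 0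
    simp [h]

/-- The elements of the `k`-th chaos are eigenvectors of `∑_a D_a` with eigenvalue `k`, in weak
form: each component of index set `J` is fixed by the `k` residuals `D_a` with `a ∈ J` and killed
by the others. -/
theorem hasSum_integral_coordResidual_mul (hG : ∀ K, condSigma Z X K ≤ mΩ)
    (hU : IsDegenerateUStatistic μ Z X k W F) (hφ : MemLp φ 2 μ) :
    HasSum (fun a => ∫ ω, coordResidual μ Z X a F ω * φ ω ∂μ) (k * ∫ ω, F ω * φ ω ∂μ) := by
  classical
  have hw := hU.hasSum_integral_component_mul hφ
  set w : {J : Finset A // J.card = k} → ℝ := fun J => ∫ ω, W J.1 ω * φ ω ∂μ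
  have hJ : ∀ (v : ℝ) (J : {J : Finset A // J.card = k}),
      HasSum (fun a => if a ∈ J.1 then v else 0) (k * v) := fun v J => by
    have h := hasSum_sum_of_ne_finset_zero (L := .unconditional A)
      (f := fun a => if a ∈ J.1 then v else 0) (s := J.1)
      fun a ha => if_neg ha
    rw [Finset.sum_ite_mem, Finset.inter_self, Finset.sum_const, J.2, nsmul_eq_mul] at h
    exact h
  set g : {J : Finset A // J.card = k} × A → ℝ := fun q => if q.2 ∈ q.1.1 then w q.1 else 0
    with hg
  have hsum : Summable g := by
    rw [← summable_abs_iff, summable_prod_of_nonneg fun q => abs_nonneg _]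
    have e : ∀ J a, |g (J, a)| = if a ∈ J.1 then |w J| else 0 := fun J a => by
      simp only [hg]; split_ifs <;> simp
    simp only [e]
    refine ⟨fun J => (hJ _ J).summable, ?_⟩
    simp only [(hJ _ _).tsum_eq]
    exact hw.summable.abs.mul_left _
  obtain ⟨T, hT⟩ := hsum
  have hT1 := hT.prod_fiberwise fun J => hJ (w J) J
  rw [(hw.mul_left (k : ℝ)).unique hT1]
  exact ((Equiv.prodComm _ _).hasSum_iff.2 hT).prod_fiberwise
    fun a => hU.hasSum_integral_component_mul_ite hG hφ a

/-- Chaoses of different orders are orthogonal. -/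
lemma integral_mul_eq_zero (hG : ∀ K, condSigma Z X K ≤ mΩ)
    (hF : IsDegenerateUStatistic μ Z X k W F) (hF' : IsDegenerateUStatistic μ Z X l V G)
    (hkl : k ≠ l) : ∫ ω, F ω * G ω ∂μ = 0 := by
  have h1 := hF.hasSum_integral_coordResidual_mul hG hF'.memLp_two
  have h2 := hF'.hasSum_integral_coordResidual_mul hG hF.memLp_two
  have e : ∀ a, ∫ ω, coordResidual μ Z X a F ω * G ω ∂μ
      = ∫ ω, coordResidual μ Z X a G ω * F ω ∂μ := fun a => by
    simp only [mul_comm _ (F _)]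
    exact integral_condResidual_mul_comm (hG _) hF.memLp_two hF'.memLp_two
  simp only [e] at h1
  have h3 := h1.unique h2
  simp only [mul_comm (G _)] at h3
  have h4 : ((k : ℝ) - l) * ∫ ω, F ω * G ω ∂μ = 0 := by linarith
  exact (mul_eq_zero.1 h4).resolve_left (sub_ne_zero.2 (Nat.cast_injective.ne hkl))

lemma integral_eq_zero (hG : ∀ K, condSigma Z X K ≤ mΩ)
    (hF : IsDegenerateUStatistic μ Z X k W F) (hk : k ≠ 0) : ∫ ω, F ω ∂μ = 0 := by
  have h := hF.hasSum_integral_coordResidual_mul hG (φ := fun _ => 1) (memLp_const 1)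
  have e : ∀ a, ∫ ω, coordResidual μ Z X a F ω * 1 ∂μ = 0 := fun a => by
    rw [coordResidual, integral_condResidual_mul_comm (hG _) hF.memLp_two (memLp_const 1)]
    simp [condResidual, condExp_const (hG _)]
  simp only [e] at h
  have := h.unique hasSum_zero
  simpa [hk] using this

lemma hasSum_integral_coordResidual_sq (hG : ∀ K, condSigma Z X K ≤ mΩ)
    (hF : IsDegenerateUStatistic μ Z X k W F) :
    HasSum (fun a => ∫ ω, coordResidual μ Z X a F ω ^ 2 ∂μ) (k * ∫ ω, F ω ^ 2 ∂μ) := by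
  have h := hF.hasSum_integral_coordResidual_mul hG hF.memLp_two
  simp only [integral_condResidual_sq (hG _) hF.memLp_two]
  simpa only [sq] using h

lemma integral_component_mul_eq_zero (hG : ∀ K, condSigma Z X K ≤ mΩ)
    (hF : IsDegenerateUStatistic μ Z X k W F) {I J : Finset A} (hI : I.card = k) (hJ : J.card = k)
    (hne : I ≠ J) : ∫ ω, W I ω * W J ω ∂μ = 0 := by
  have hnot : ¬ I ⊆ J := fun h => hne (Finset.eq_of_subset_of_card_le h (by omega))
  obtain ⟨a, haI, haJ⟩ := Finset.not_subset.1 hnot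
  have h1 := integral_condResidual_mul_comm (hG {a}ᶜ) (hF.memLp_component I hI)
    (hF.memLp_component J hJ)
  have h2 : ∫ ω, condResidual (condSigma Z X {a}ᶜ) μ (W I) ω * W J ω ∂μ
      = ∫ ω, W I ω * W J ω ∂μ := by
    refine integral_congr_ae ?_
    filter_upwards [hF.coordResidual_of_mem hI haI] with ω h
    rw [← h]
  rw [← h2, h1]
  refine integral_eq_zero_of_ae ?_
  filter_upwards [hF.coordResidual_of_notMem hG hJ haJ] with ω h
  change W I ω * coordResidual μ Z X a (W J) ω = 0
  simp [h]

lemma integral_component_mul_self (hG : ∀ K, condSigma Z X K ≤ mΩ)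
    (hF : IsDegenerateUStatistic μ Z X k W F) {J : Finset A} (hJ : J.card = k) :
    ∫ ω, W J ω * F ω ∂μ = ∫ ω, W J ω ^ 2 ∂μ := by
  have h := hF.hasSum_integral_component_mul (hF.memLp_component J hJ)
  have h2 := hasSum_single (f := fun I : {I : Finset A // I.card = k} => ∫ ω, W I.1 ω * W J ω ∂μ)
    ⟨J, hJ⟩ fun I hI => hF.integral_component_mul_eq_zero hG I.2 hJ fun h => hI (Subtype.ext h)
  have := h.unique h2
  simp only [mul_comm (F _), sq] at this ⊢
  exact this

open Classical in
/-- The influence `∑_{J ∋ a} E[W_J²]` of the coordinate `a` is `E[(D_a F)²]`. -/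
lemma hasSum_integral_component_sq_ite (hG : ∀ K, condSigma Z X K ≤ mΩ)
    (hF : IsDegenerateUStatistic μ Z X k W F) (a : A) :
    HasSum (fun J : {J : Finset A // J.card = k} =>
      if a ∈ J.1 then ∫ ω, W J.1 ω ^ 2 ∂μ else 0) (∫ ω, coordResidual μ Z X a F ω ^ 2 ∂μ) := by
  have h := hF.hasSum_integral_component_mul_ite hG hF.memLp_two a
  rw [← integral_condResidual_sq (hG _) hF.memLp_two] at h
  refine h.congr_fun fun J => ?_
  rw [hF.integral_component_mul_self hG J.2]

/-- The influence of a coordinate is at most the square of the maximal influence. -/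
lemma integral_coordResidual_sq_le_maxInfluence_sq (hG : ∀ K, condSigma Z X K ≤ mΩ)
    (hF : IsDegenerateUStatistic μ Z X k W F) (a : A) :
    ∫ ω, coordResidual μ Z X a F ω ^ 2 ∂μ ≤ maxInfluence μ k W ^ 2 := by
  classical
  have key : ∀ a : A, ∑' J : {J : Finset A // J.card = k ∧ a ∈ J},
      ∫⁻ ω, ENNReal.ofReal (W J.1 ω ^ 2) ∂μ
      = ENNReal.ofReal (∫ ω, coordResidual μ Z X a F ω ^ 2 ∂μ) := fun a => by
    have h := hF.hasSum_integral_component_sq_ite hG a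
    have e : (fun J : {J : Finset A // J.card = k} =>
        if a ∈ J.1 then ∫ ω, W J.1 ω ^ 2 ∂μ else 0)
        = ({J | a ∈ J.1} : Set {J : Finset A // J.card = k}).indicator
          fun J => ∫ ω, W J.1 ω ^ 2 ∂μ := by
      ext J; simp [Set.indicator_apply]
    rw [e, ← hasSum_subtype_iff_indicator] at h
    have h' := (Equiv.subtypeSubtypeEquivSubtypeInter (fun J : Finset A => J.card = k)
      (fun J => a ∈ J)).symm.hasSum_iff.2 h
    rw [← h'.tsum_eq]
    refine Eq.trans ?_ (ENNReal.ofReal_tsum_of_nonneg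
      (fun J => integral_nonneg fun ω => sq_nonneg _) h'.summable).symm
    refine tsum_congr fun J => ?_
    exact (ofReal_integral_eq_lintegral_ofReal (hF.memLp_component J.1 J.2.1).integrable_sq
      (.of_forall fun ω => sq_nonneg _)).symm
  rw [maxInfluence, Real.sq_sqrt ENNReal.toReal_nonneg]
  simp only [key]
  have hbdd : ⨆ a : A, ENNReal.ofReal (∫ ω, coordResidual μ Z X a F ω ^ 2 ∂μ)
      ≤ ENNReal.ofReal (k * ∫ ω, F ω ^ 2 ∂μ) := iSup_le fun a => ENNReal.ofReal_le_ofReal <|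
    le_hasSum (hF.hasSum_integral_coordResidual_sq hG) a
      fun b _ => integral_nonneg fun ω => sq_nonneg _
  have h := ENNReal.toReal_mono (hbdd.trans_lt ENNReal.ofReal_lt_top).ne
    (le_iSup (fun a : A => ENNReal.ofReal (∫ ω, coordResidual μ Z X a F ω ^ 2 ∂μ)) a)
  rwa [ENNReal.toReal_ofReal (integral_nonneg fun ω => sq_nonneg _)] at h

end IsDegenerateUStatistic

end ChaosExpansion

/-! ### Fourth moments -/

section FourthMoment

variable {Ω A E₀ : Type*} {E : A → Type*} [MeasurableSpace E₀] [∀ a, MeasurableSpace (E a)]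
  {Z : Ω → E₀} {X : ∀ a, Ω → E a} {mΩ : MeasurableSpace Ω} {μ : Measure Ω}

/-- Fatou's lemma for fourth moments along an `L²`-convergent net. -/
lemma integral_pow_four_le_of_tendsto {ι : Type*} {l : Filter ι} [l.NeBot]
    [l.IsCountablyGenerated] {f : ι → Ω → ℝ} {g : Ω → ℝ} {c : ℝ} (hc : 0 ≤ c)
    (hf : ∀ i, MemLp (f i) 4 μ) (hg : MemLp g 4 μ)
    (h : Tendsto (fun i => eLpNorm (f i - g) 2 μ) l (𝓝 0))
    (hle : ∀ i, ∫ ω, f i ω ^ 4 ∂μ ≤ c) : ∫ ω, g ω ^ 4 ∂μ ≤ c := by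
  obtain ⟨ns, -, hns⟩ := (tendstoInMeasure_of_tendsto_eLpNorm two_ne_zero (fun i => (hf i).1) hg.1
    h).exists_seq_tendsto_ae'
  have e : ∀ {f : Ω → ℝ}, MemLp f 4 μ →
      ∫⁻ ω, ENNReal.ofReal (f ω ^ 4) ∂μ = ENNReal.ofReal (∫ ω, f ω ^ 4 ∂μ) := fun hf =>
    (ofReal_integral_eq_lintegral_ofReal hf.integrable_pow_four
      (.of_forall fun ω => by positivity)).symm
  rw [← ENNReal.ofReal_le_ofReal_iff hc, ← e hg]
  calc ∫⁻ ω, ENNReal.ofReal (g ω ^ 4) ∂μ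
      = ∫⁻ ω, liminf (fun n => ENNReal.ofReal (f (ns n) ω ^ 4)) atTop ∂μ := by
        refine lintegral_congr_ae ?_
        filter_upwards [hns] with ω hω
        exact (ENNReal.tendsto_ofReal (hω.pow 4)).liminf_eq.symm
    _ ≤ liminf (fun n => ∫⁻ ω, ENNReal.ofReal (f (ns n) ω ^ 4) ∂μ) atTop :=
        lintegral_liminf_le' fun n => ((hf _).1.aemeasurable.pow_const 4).ennreal_ofReal
    _ ≤ ENNReal.ofReal c := by
        refine liminf_le_of_le (by isBoundedDefault) fun b hb => ?_
        obtain ⟨n, hn⟩ := hb.exists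
        exact hn.trans (by rw [e (hf _)]; exact ENNReal.ofReal_le_ofReal (hle _))

namespace IsDegenerateUStatistic

variable [IsProbabilityMeasure μ]

variable {k : ℕ} {W : Finset A → Ω → ℝ} {F : Ω → ℝ}

/-- A Bonami-type inequality, by induction on the set `U` of coordinates that have been split off.
Distinct index sets of `𝒥` are still distinguished by `U`, so that at most one is left for
`U = ∅`. -/
lemma sqrt_integral_sum_pow_four_le [DecidableEq A] (hG : ∀ K, condSigma Z X K ≤ mΩ)
    (hF : IsDegenerateUStatistic μ Z X k W F) (h4 : ∀ J, J.card = k → MemLp (W J) 4 μ)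
    (U : Finset A) (𝒥 : Finset (Finset A)) (hcard : ∀ J ∈ 𝒥, J.card = k)
    (hinj : Set.InjOn (fun J => J ∩ U) (𝒥 : Set (Finset A))) :
    √(∫ ω, (∑ J ∈ 𝒥, W J ω) ^ 4 ∂μ) ≤ ∑ J ∈ 𝒥, 4 ^ (J ∩ U).card * √(∫ ω, W J ω ^ 4 ∂μ) := by
  induction U using Finset.induction_on generalizing 𝒥 with
  | empty =>
    have hsub : (𝒥 : Set (Finset A)).Subsingleton := fun I hI J hJ => hinj hI hJ (by simp)
    rcases 𝒥.eq_empty_or_nonempty with rfl | ⟨J, hJ⟩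
    · simp
    · have : 𝒥 = {J} := Finset.eq_singleton_iff_unique_mem.2 ⟨hJ, fun I hI => hsub hI hJ⟩
      subst this
      simp
  | insert a U ha ih =>
    set 𝒥₀ := 𝒥.filter (a ∉ ·)
    set 𝒥₁ := 𝒥.filter (a ∈ ·)
    have m0 : ∀ J ∈ 𝒥₀, J ∈ 𝒥 ∧ a ∉ J := fun J hJ => Finset.mem_filter.1 hJ
    have m1 : ∀ J ∈ 𝒥₁, J ∈ 𝒥 ∧ a ∈ J := fun J hJ => Finset.mem_filter.1 hJ
    have i0 := ih 𝒥₀ (fun J hJ => hcard J (m0 J hJ).1) fun I hI J hJ h =>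
      hinj (m0 I hI).1 (m0 J hJ).1 (by
        simpa [Finset.inter_insert_of_notMem (m0 I hI).2,
          Finset.inter_insert_of_notMem (m0 J hJ).2] using h)
    have i1 := ih 𝒥₁ (fun J hJ => hcard J (m1 J hJ).1) fun I hI J hJ h =>
      hinj (m1 I hI).1 (m1 J hJ).1 (by
        have h : I ∩ U = J ∩ U := h
        simp only [Finset.inter_insert_of_mem (m1 I hI).2,
          Finset.inter_insert_of_mem (m1 J hJ).2, h])
    have step := sqrt_integral_add_pow_four_le (hG {a}ᶜ) (μ := μ)
      (Y := ∑ J ∈ 𝒥₀, W J) (T := ∑ J ∈ 𝒥₁, W J)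
      (memLp_finsetSum' _ fun J hJ => h4 J (hcard J (m0 J hJ).1))
      (memLp_finsetSum' _ fun J hJ => h4 J (hcard J (m1 J hJ).1))
      (Finset.sum_induction _ (AEStronglyMeasurable[condSigma Z X {a}ᶜ] · μ)
        (fun _ _ hf hg => hf.add hg) aestronglyMeasurable_zero fun J hJ =>
        hF.aestronglyMeasurable_of_notMem (hcard J (m0 J hJ).1) (m0 J hJ).2)
      ((condExp_finsetSum (fun J hJ => (hF.memLp_component J
        (hcard J (m1 J hJ).1)).integrable one_le_two) _).trans
        (((eventually_all_finset 𝒥₁).2 fun J hJ => hF.condExp_component J (hcard J (m1 J hJ).1)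
          {a}ᶜ fun h => h (m1 J hJ).2 rfl).mono fun ω hω => by
            rw [Finset.sum_apply]; exact Finset.sum_eq_zero hω))
    have split : ∀ f : Finset A → ℝ, ∑ J ∈ 𝒥, f J = ∑ J ∈ 𝒥₀, f J + ∑ J ∈ 𝒥₁, f J := fun f => by
      rw [add_comm]; exact (Finset.sum_filter_add_sum_filter_not 𝒥 (a ∈ ·) f).symm
    simp only [Finset.sum_apply] at step
    simp only [split]
    refine step.trans ?_
    have s0 : ∑ J ∈ 𝒥₀, 4 ^ (J ∩ insert a U).card * √(∫ ω, W J ω ^ 4 ∂μ)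
        = ∑ J ∈ 𝒥₀, 4 ^ (J ∩ U).card * √(∫ ω, W J ω ^ 4 ∂μ) :=
      Finset.sum_congr rfl fun J hJ => by rw [Finset.inter_insert_of_notMem (m0 J hJ).2]
    have s1 : ∑ J ∈ 𝒥₁, 4 ^ (J ∩ insert a U).card * √(∫ ω, W J ω ^ 4 ∂μ)
        = 4 * ∑ J ∈ 𝒥₁, 4 ^ (J ∩ U).card * √(∫ ω, W J ω ^ 4 ∂μ) := by
      rw [Finset.mul_sum]
      refine Finset.sum_congr rfl fun J hJ => ?_
      rw [Finset.inter_insert_of_mem (m1 J hJ).2, Finset.card_insert_of_notMem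
        fun h => ha (Finset.mem_inter.1 h).2]
      ring
    rw [s0, s1]
    gcongr

lemma integral_sum_pow_four_le (hG : ∀ K, condSigma Z X K ≤ mΩ)
    (hF : IsDegenerateUStatistic μ Z X k W F) {κ : ℝ} (hκ : IsHypercontractive μ k W κ)
    (𝒥 : Finset (Finset A)) (hcard : ∀ J ∈ 𝒥, J.card = k) :
    ∫ ω, (∑ J ∈ 𝒥, W J ω) ^ 4 ∂μ ≤ (4 ^ k * √κ * ∑ J ∈ 𝒥, ∫ ω, W J ω ^ 2 ∂μ) ^ 2 := by
  classical
  have hsub : ∀ J ∈ 𝒥, J ∩ 𝒥.biUnion id = J := fun J hJ =>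
    Finset.inter_eq_left.2 (Finset.subset_biUnion_of_mem id hJ)
  have h := hF.sqrt_integral_sum_pow_four_le hG (fun J hJ => (hκ J hJ).1) (𝒥.biUnion id) 𝒥 hcard
    fun I hI J hJ h => by simpa [hsub I hI, hsub J hJ] using h
  refine (Real.sqrt_le_left (by positivity)).1 (h.trans ?_)
  rw [Finset.mul_sum]
  refine Finset.sum_le_sum fun J hJ => ?_
  rw [hsub J hJ, hcard J hJ, mul_assoc]
  gcongr
  refine (Real.sqrt_le_sqrt (hκ J (hcard J hJ)).2).trans (le_of_eq ?_)
  rw [Real.sqrt_mul' _ (sq_nonneg _), Real.sqrt_sq (integral_nonneg fun ω => sq_nonneg _)]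

open Classical in
lemma tendsto_sum_coordResidual (hG : ∀ K, condSigma Z X K ≤ mΩ)
    (hF : IsDegenerateUStatistic μ Z X k W F) (a : A) :
    Tendsto (fun S : Finset {J : Finset A // J.card = k} =>
      eLpNorm ((fun ω => ∑ J ∈ S with a ∈ J.1, W J.1 ω) - coordResidual μ Z X a F) 2 μ)
      atTop (𝓝 0) := by
  have h2 : Tendsto (fun S : Finset {J : Finset A // J.card = k} =>
      2 * eLpNorm (fun ω => F ω - ∑ J ∈ S, W J.1 ω) 2 μ) atTop (𝓝 0) := by
    simpa using ENNReal.Tendsto.const_mul hF.tendsto_sum (.inr ENNReal.ofNat_ne_top)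
  -- the partial sum is `D_a` of a partial sum of `F`, and `‖D_a g‖₂ ≤ 2 ‖g‖₂`
  refine tendsto_of_tendsto_of_tendsto_of_le_of_le tendsto_const_nhds h2 (fun _ => zero_le)
    fun S => ?_
  set FS : Ω → ℝ := ∑ J ∈ S, W J.1 with hFS
  have mW : ∀ J ∈ S, MemLp (W J.1) 2 μ := fun J _ => hF.memLp_component J.1 J.2
  have mFS : MemLp FS 2 μ := memLp_finsetSum' _ mW
  have hFF := hF.memLp_two.sub mFS
  have hsub := condExp_sub (hF.memLp_two.integrable one_le_two) (mFS.integrable one_le_two)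
    (condSigma Z X {a}ᶜ)
  have hsum := condExp_finsetSum (fun J hJ => (mW J hJ).integrable one_le_two)
    (condSigma Z X {a}ᶜ)
  have hcomp : ∀ᵐ ω ∂μ, ∀ J ∈ S, (μ[W J.1 | condSigma Z X {a}ᶜ]) ω
      = if a ∈ J.1 then 0 else W J.1 ω := (eventually_all_finset S).2 fun J _ => by
    by_cases ha : a ∈ J.1
    · filter_upwards [hF.coordResidual_of_mem J.2 ha] with ω h
      simp only [condResidual] at h; simp [ha]; linarith
    · filter_upwards [hF.coordResidual_of_notMem hG J.2 ha] with ω h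
      simp only [condResidual, Pi.zero_apply] at h; simp [ha]; linarith
  have e : (fun ω => ∑ J ∈ S with a ∈ J.1, W J.1 ω) - coordResidual μ Z X a F =ᵐ[μ]
      -condResidual (condSigma Z X {a}ᶜ) μ (F - FS) := by
    filter_upwards [hsub, hsum, hcomp] with ω h1 h2 h3
    simp only [Pi.sub_apply, Pi.neg_apply, condResidual] at h1 ⊢
    rw [h1, h2, Finset.sum_apply, Finset.sum_congr rfl h3, hFS, Finset.sum_apply,
      Finset.sum_filter]
    have : ∑ J ∈ S, W J.1 ω = ∑ J ∈ S, (if a ∈ J.1 then W J.1 ω else 0)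
        + ∑ J ∈ S, (if a ∈ J.1 then 0 else W J.1 ω) := by
      rw [← Finset.sum_add_distrib]
      exact Finset.sum_congr rfl fun J _ => by split_ifs <;> simp
    rw [this]; ring
  rw [eLpNorm_congr_ae e, eLpNorm_neg]
  have hFSe : (fun ω => F ω - ∑ J ∈ S, W J.1 ω) = F - FS := by
    ext ω; simp [hFS]
  rw [hFSe, two_mul]
  exact (eLpNorm_sub_le hFF.1 (hFF.condExp one_le_two).1 one_le_two).trans
    (add_le_add le_rfl (eLpNorm_condExp_le_eLpNorm _ one_le_two))

/-- Hypercontractivity of `D_a F`, whose components are the `W_J` with `a ∈ J`. -/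
lemma integral_coordResidual_pow_four_le [Countable A] (hG : ∀ K, condSigma Z X K ≤ mΩ)
    (hF : IsDegenerateUStatistic μ Z X k W F) (hF4 : MemLp F 4 μ) {κ : ℝ}
    (hκ : IsHypercontractive μ k W κ) (a : A) :
    ∫ ω, coordResidual μ Z X a F ω ^ 4 ∂μ
      ≤ (4 ^ k * √κ * ∫ ω, coordResidual μ Z X a F ω ^ 2 ∂μ) ^ 2 := by
  classical
  refine integral_pow_four_le_of_tendsto (sq_nonneg _)
    (fun S => memLp_finsetSum _ fun J _ => (hκ J.1 J.2).1) (hF4.condResidual (by norm_num))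
    (hF.tendsto_sum_coordResidual hG a) fun S => ?_
  have h := hF.integral_sum_pow_four_le hG hκ
    ((S.filter fun J => a ∈ J.1).map (Function.Embedding.subtype _)) fun J hJ => by
      obtain ⟨I, -, rfl⟩ := Finset.mem_map.1 hJ
      exact I.2
  simp only [Finset.sum_map, Function.Embedding.subtype_apply] at h
  refine h.trans ?_
  have hs : ∑ J ∈ S with a ∈ J.1, ∫ ω, W J.1 ω ^ 2 ∂μ
      ≤ ∫ ω, coordResidual μ Z X a F ω ^ 2 ∂μ := by
    rw [Finset.sum_filter]
    exact sum_le_hasSum S (fun J _ => by split_ifs <;> positivity)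
      (hF.hasSum_integral_component_sq_ite hG a)
  gcongr

end IsDegenerateUStatistic

end FourthMoment

/-! ### The fourth moment inequality -/

section FourthMomentInequality

variable {Ω A E₀ : Type*} {E : A → Type*} [MeasurableSpace E₀] [∀ a, MeasurableSpace (E a)]
  {Z : Ω → E₀} {X : ∀ a, Ω → E a} {mΩ : MeasurableSpace Ω} {μ : Measure Ω}

/-- The cube, truncated to values in `[-M, M]`. -/
def truncatedCube (M x : ℝ) : ℝ := max (-M) (min (x ^ 3) M)

lemma continuous_truncatedCube (M : ℝ) : Continuous (truncatedCube M) := by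
  unfold truncatedCube; fun_prop

lemma abs_truncatedCube_le {M : ℝ} (hM : 0 ≤ M) (x : ℝ) : |truncatedCube M x| ≤ M :=
  abs_le.2 ⟨le_max_left _ _, max_le (by linarith) (min_le_right _ _)⟩

lemma abs_truncatedCube_le_pow {M : ℝ} (hM : 0 ≤ M) (x : ℝ) : |truncatedCube M x| ≤ |x| ^ 3 := by
  rw [← abs_pow, abs_le, truncatedCube]
  have h := neg_abs_le (x ^ 3)
  have h' := le_abs_self (x ^ 3)
  have h0 := abs_nonneg (x ^ 3)
  refine ⟨le_max_of_le_right (le_min h (by linarith)), max_le (by linarith)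
    ((min_le_left _ _).trans h')⟩

lemma truncatedCube_eq {M x : ℝ} (h : |x ^ 3| ≤ M) : truncatedCube M x = x ^ 3 := by
  rw [truncatedCube, min_eq_left (abs_le.1 h).2, max_eq_right (abs_le.1 h).1]

lemma monotone_cube_sub_truncatedCube {M : ℝ} (hM : 0 ≤ M) :
    Monotone fun x => x ^ 3 - truncatedCube M x := by
  have e : ∀ x : ℝ, x ^ 3 - truncatedCube M x = max (x ^ 3 - M) 0 + min (x ^ 3 + M) 0 := fun x => by
    rw [truncatedCube]
    rcases le_total (x ^ 3) M with h | h <;> rcases le_total (-M) (x ^ 3) with h' | h'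
    · rw [min_eq_left h, max_eq_right h', max_eq_right (by linarith), min_eq_right (by linarith)]
      ring
    · rw [min_eq_left h, max_eq_left h', max_eq_right (by linarith), min_eq_left (by linarith)]
      ring
    · rw [min_eq_right h, max_eq_right (by linarith), max_eq_left (by linarith),
        min_eq_right (by linarith)]
      ring
    · rw [min_eq_right h, max_eq_right (by linarith), max_eq_left (by linarith),
        min_eq_right (by linarith)]
      ring
  intro x y hxy
  have h3 : x ^ 3 ≤ y ^ 3 := Odd.pow_le_pow (by decide) |>.2 hxy
  simp only [e]
  gcongr

lemma tendsto_integral_mul_truncatedCube {F : Ω → ℝ} (hF : MemLp F 4 μ) :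
    Tendsto (fun n : ℕ => ∫ ω, F ω * truncatedCube n (F ω) ∂μ) atTop (𝓝 (∫ ω, F ω ^ 4 ∂μ)) := by
  refine tendsto_integral_of_dominated_convergence (fun ω => F ω ^ 4)
    (fun n => hF.1.mul ((continuous_truncatedCube n).comp_aestronglyMeasurable hF.1))
    hF.integrable_pow_four (fun n => .of_forall fun ω => ?_) (.of_forall fun ω => ?_)
  · rw [Real.norm_eq_abs, abs_mul, ← Even.pow_abs (by decide : Even 4), pow_succ' _ 3]
    exact mul_le_mul_of_nonneg_left (abs_truncatedCube_le_pow n.cast_nonneg _) (abs_nonneg _)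
  · obtain ⟨N, hN⟩ := exists_nat_ge |F ω ^ 3|
    refine tendsto_const_nhds.congr' ?_
    filter_upwards [eventually_ge_atTop N] with n hn
    rw [truncatedCube_eq (hN.trans (by exact_mod_cast hn))]
    ring

variable [IsProbabilityMeasure μ]

/-- The inequality `k E[F⁴] ≤ (3/4) ∑_a E[(D_a F²)²] + ∑_a E[(D_a F)⁴]`. The identity
`k E[F φ] = ∑_a E[D_a F φ]` is only available for square-integrable `φ`, and is applied to the
truncations of `F³`. -/
lemma IsDegenerateUStatistic.mul_integral_pow_four_le {k : ℕ} {W : Finset A → Ω → ℝ} {F : Ω → ℝ}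
    (hG : ∀ K, condSigma Z X K ≤ mΩ) (hF : IsDegenerateUStatistic μ Z X k W F)
    (hF4 : MemLp F 4 μ) {S R : ℝ}
    (hS : HasSum (fun a => ∫ ω, coordResidual μ Z X a (fun ω => F ω ^ 2) ω ^ 2 ∂μ) S)
    (hR : HasSum (fun a => ∫ ω, coordResidual μ Z X a F ω ^ 4 ∂μ) R) :
    k * ∫ ω, F ω ^ 4 ∂μ ≤ 3 / 4 * S + R := by
  refine le_of_tendsto ((tendsto_integral_mul_truncatedCube hF4).const_mul (k : ℝ))
    (.of_forall fun n => ?_)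
  have hn : (0 : ℝ) ≤ n := n.cast_nonneg
  exact hasSum_le (fun a => integral_condResidual_mul_comp_le (hG _) hF4
      (continuous_truncatedCube n) (abs_truncatedCube_le hn) (monotone_cube_sub_truncatedCube hn))
    (hF.hasSum_integral_coordResidual_mul hG (MemLp.comp_of_abs_le (continuous_truncatedCube n)
      (abs_truncatedCube_le hn) hF4.1 2)) ((hS.mul_left (3 / 4)).add hR)

end FourthMomentInequality

/-! ### The carré du champ -/

section CarreDuChamp

variable {Ω A E₀ : Type*} {E : A → Type*} [MeasurableSpace E₀] [∀ a, MeasurableSpace (E a)]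
  {Z : Ω → E₀} {X : ∀ a, Ω → E a} {mΩ : MeasurableSpace Ω} {μ : Measure Ω}

lemma integral_sum_mul_sum_of_orthogonal {ι : Type*} [DecidableEq ι] {s : Finset ι}
    {G : ι → Ω → ℝ} (hG : ∀ k ∈ s, MemLp (G k) 2 μ)
    (ho : ∀ k ∈ s, ∀ l ∈ s, k ≠ l → ∫ ω, G k ω * G l ω ∂μ = 0) (c d : ι → ℝ) :
    ∫ ω, (∑ k ∈ s, c k * G k ω) * (∑ k ∈ s, d k * G k ω) ∂μ
      = ∑ k ∈ s, c k * d k * ∫ ω, G k ω ^ 2 ∂μ := by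
  have hint : ∀ k ∈ s, ∀ l ∈ s, Integrable (fun ω => c k * G k ω * (d l * G l ω)) μ :=
    fun k hk l hl => (((hG k hk).integrable_mul_two (hG l hl)).const_mul (c k * d l)).congr
      (.of_forall fun ω => by simp only; ring)
  simp only [Finset.sum_mul_sum]
  rw [integral_finsetSum _ fun k hk => integrable_finsetSum _ fun l hl => hint k hk l hl]
  refine Finset.sum_congr rfl fun k hk => ?_
  rw [integral_finsetSum _ fun l hl => hint k hk l hl]
  have e : ∀ l, ∫ ω, c k * G k ω * (d l * G l ω) ∂μ = c k * d l * ∫ ω, G k ω * G l ω ∂μ :=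
    fun l => by
      rw [← integral_const_mul]; congr 1; ext ω; ring
  simp only [e]
  rw [Finset.sum_eq_single_of_mem k hk fun l hl hlk => by rw [ho k hk l hl hlk.symm, mul_zero]]
  simp only [sq]

/-- `∑_a D_a` acts on a finite sum of chaoses by multiplying the part of order `k` by `k`. -/
lemma hasSum_integral_coordResidual_sum_mul [IsProbabilityMeasure μ]
    (hG : ∀ K, condSigma Z X K ≤ mΩ) {s : Finset ℕ}
    {V : ℕ → Finset A → Ω → ℝ} {G : ℕ → Ω → ℝ} {u φ : Ω → ℝ}
    (hV : ∀ k ∈ s, IsDegenerateUStatistic μ Z X k (V k) (G k)) (hu : MemLp u 2 μ)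
    (huG : u =ᵐ[μ] fun ω => ∑ k ∈ s, G k ω) (hφ : MemLp φ 2 μ) :
    HasSum (fun a => ∫ ω, coordResidual μ Z X a u ω * φ ω ∂μ)
      (∑ k ∈ s, k * ∫ ω, G k ω * φ ω ∂μ) := by
  refine (hasSum_sum fun k hk => (hV k hk).hasSum_integral_coordResidual_mul hG hφ).congr_fun
    fun a => ?_
  have hR := hφ.condResidual (m := condSigma Z X {a}ᶜ) one_le_two
  rw [integral_condResidual_mul_comm (hG _) hu hφ, Finset.sum_congr rfl fun k hk =>
    integral_condResidual_mul_comm (hG _) (hV k hk).memLp_two hφ,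
    ← integral_finsetSum _ fun k hk => (hV k hk).memLp_two.integrable_mul_two hR]
  refine integral_congr_ae ?_
  filter_upwards [huG] with ω hω
  rw [hω, Finset.sum_mul]

/-- The normalized carré du champ `Γ = ∑_{k ≤ 2p} (1 - k / (2p)) G_k` of `F`, where `G_k` is the
part of `F²` in the chaos of order `k`. -/
noncomputable def normalizedCarreDuChamp (p : ℕ) (G : ℕ → Ω → ℝ) (ω : Ω) : ℝ :=
  ∑ k ∈ Finset.range (2 * p + 1), (1 - k / (2 * p)) * G k ω

variable {p : ℕ} {W : Finset A → Ω → ℝ} {F : Ω → ℝ} {V : ℕ → Finset A → Ω → ℝ}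
  {G : ℕ → Ω → ℝ}

lemma memLp_normalizedCarreDuChamp
    (hV : ∀ k ∈ Finset.range (2 * p + 1), IsDegenerateUStatistic μ Z X k (V k) (G k)) :
    MemLp (normalizedCarreDuChamp p G) 2 μ :=
  memLp_finsetSum _ fun k hk => (hV k hk).memLp_two.const_mul _

variable [IsProbabilityMeasure μ]

/-- The spectral bound on the variance of the carré du champ. Since `F²` has no chaos part of order
above `2p`, the eigenvalues `c = 1 - k / (2p)` satisfy `c² ≤ c`, whence
`E[Γ²] ≤ E[F⁴] - (2p)⁻¹ ∑_a E[(D_a F²)²]`; the last sum is bounded below by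
`IsDegenerateUStatistic.mul_integral_pow_four_le`. -/
lemma integral_one_sub_normalizedCarreDuChamp_sq_le (hG : ∀ K, condSigma Z X K ≤ mΩ) (hp : 1 ≤ p)
    (hF : IsDegenerateUStatistic μ Z X p W F) (hF4 : MemLp F 4 μ) (hvar : ∫ ω, F ω ^ 2 ∂μ = 1)
    (hV : ∀ k ∈ Finset.range (2 * p + 1), IsDegenerateUStatistic μ Z X k (V k) (G k))
    (huG : (fun ω => F ω ^ 2) =ᵐ[μ] fun ω => ∑ k ∈ Finset.range (2 * p + 1), G k ω) {R : ℝ}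
    (hR : HasSum (fun a => ∫ ω, coordResidual μ Z X a F ω ^ 4 ∂μ) R) :
    ∫ ω, (1 - normalizedCarreDuChamp p G ω) ^ 2 ∂μ
      ≤ (∫ ω, F ω ^ 4 ∂μ - 3) / 3 + 2 / (3 * p) * R := by
  have hp0 : (0 : ℝ) < p := by exact_mod_cast hp
  set s := Finset.range (2 * p + 1) with hs
  have ho : ∀ k ∈ s, ∀ l ∈ s, k ≠ l → ∫ ω, G k ω * G l ω ∂μ = 0 := fun k hk l hl hkl =>
    (hV k hk).integral_mul_eq_zero hG (hV l hl) hkl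
  have mG : ∀ k ∈ s, MemLp (G k) 2 μ := fun k hk => (hV k hk).memLp_two
  have mu := hF4.sq_memLp_two
  have mΓ := memLp_normalizedCarreDuChamp hV
  have orth := integral_sum_mul_sum_of_orthogonal mG ho
  -- the fourth moment and the energy in terms of the chaos parts of `F²`
  have hGu : ∀ k ∈ s, ∫ ω, G k ω * F ω ^ 2 ∂μ = ∫ ω, G k ω ^ 2 ∂μ := fun k hk => by
    have h := orth (fun l => if l = k then 1 else 0) (fun _ => 1)
    simp only [ite_mul, one_mul, zero_mul, Finset.sum_ite_eq', hk, if_true] at h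
    rw [← h]
    refine integral_congr_ae ?_
    filter_upwards [huG] with ω hω
    rw [hω]
  have h4 : ∫ ω, F ω ^ 4 ∂μ = ∑ k ∈ s, ∫ ω, G k ω ^ 2 ∂μ := by
    have h := orth (fun _ => 1) (fun _ => 1)
    simp only [one_mul] at h
    rw [← h]
    refine integral_congr_ae ?_
    filter_upwards [huG] with ω hω
    rw [← hω]; ring
  have hS : HasSum (fun a => ∫ ω, coordResidual μ Z X a (fun ω => F ω ^ 2) ω ^ 2 ∂μ)
      (∑ k ∈ s, k * ∫ ω, G k ω ^ 2 ∂μ) := by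
    have h := hasSum_integral_coordResidual_sum_mul hG hV mu huG mu
    rw [Finset.sum_congr rfl fun k hk => by rw [hGu k hk]] at h
    simpa only [integral_condResidual_sq (hG _) mu] using h
  have key := hF.mul_integral_pow_four_le hG hF4 hS hR
  -- the mean of the carré du champ
  have hΓ1 : ∫ ω, normalizedCarreDuChamp p G ω ∂μ = 1 := by
    rw [← hvar, integral_congr_ae huG, integral_finsetSum _ fun k hk =>
      (mG k hk).integrable one_le_two]
    simp only [normalizedCarreDuChamp]
    rw [integral_finsetSum _ fun k hk => ((mG k hk).integrable one_le_two).const_mul _]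
    refine Finset.sum_congr rfl fun k hk => ?_
    rw [integral_const_mul]
    rcases eq_or_ne k 0 with rfl | h0
    · simp
    · rw [(hV k hk).integral_eq_zero hG h0, mul_zero]
  have hΓ2 : ∫ ω, normalizedCarreDuChamp p G ω ^ 2 ∂μ
      ≤ ∑ k ∈ s, (1 - (k : ℝ) / (2 * p)) * ∫ ω, G k ω ^ 2 ∂μ := by
    simp only [sq (normalizedCarreDuChamp p G _)]
    refine (orth _ _).trans_le (Finset.sum_le_sum fun k hk => ?_)
    have hk' : (k : ℝ) ≤ 2 * p := by
      exact_mod_cast Nat.lt_succ_iff.1 (Finset.mem_range.1 hk)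
    have h1 : (k : ℝ) / (2 * p) ≤ 1 := (div_le_one (by positivity)).2 hk'
    have h2 : 0 ≤ (k : ℝ) / (2 * p) := by positivity
    refine mul_le_mul_of_nonneg_right ?_ (integral_nonneg fun ω => sq_nonneg _)
    exact mul_le_of_le_one_right (by linarith) (by linarith)
  have hΓ3 : ∑ k ∈ s, (1 - (k : ℝ) / (2 * p)) * ∫ ω, G k ω ^ 2 ∂μ
      = ∫ ω, F ω ^ 4 ∂μ - (∑ k ∈ s, k * ∫ ω, G k ω ^ 2 ∂μ) / (2 * p) := by
    rw [h4, Finset.sum_div, ← Finset.sum_sub_distrib]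
    exact Finset.sum_congr rfl fun k _ => by ring
  have hexp : ∫ ω, (1 - normalizedCarreDuChamp p G ω) ^ 2 ∂μ
      = 1 - 2 * ∫ ω, normalizedCarreDuChamp p G ω ∂μ
        + ∫ ω, normalizedCarreDuChamp p G ω ^ 2 ∂μ := by
    have i1 := mΓ.integrable one_le_two
    have e : ∀ ω, (1 - normalizedCarreDuChamp p G ω) ^ 2
        = (1 - 2 * normalizedCarreDuChamp p G ω) + normalizedCarreDuChamp p G ω ^ 2 :=
      fun ω => by ring
    simp only [e]
    rw [integral_add ((integrable_const _).sub' (i1.const_mul 2)) mΓ.integrable_sq,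
      integral_sub (integrable_const _) (i1.const_mul 2), integral_const_mul]
    simp
  rw [hexp, hΓ1]
  have h5 : 2 / 3 * ∫ ω, F ω ^ 4 ∂μ - 2 / (3 * p) * R
      ≤ (∑ k ∈ s, k * ∫ ω, G k ω ^ 2 ∂μ) / (2 * p) := by
    rw [le_div_iff₀ (by positivity)]
    have : (2 / 3 * ∫ ω, F ω ^ 4 ∂μ - 2 / (3 * p) * R) * (2 * p)
        = 4 / 3 * (p * ∫ ω, F ω ^ 4 ∂μ - R) := by field_simp; ring
    rw [this]; linarith
  linarith

/-- Stein's method: the carré du champ replaces the variance of `F` up to the third-order terms of a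
Taylor expansion, which are interpolated between second and fourth moments with a free parameter
`η`. -/
lemma abs_integral_mul_sub_integral_mul_normalizedCarreDuChamp_le
    (hG : ∀ K, condSigma Z X K ≤ mΩ) (hp : 1 ≤ p)
    (hF : IsDegenerateUStatistic μ Z X p W F) (hF4 : MemLp F 4 μ) (hvar : ∫ ω, F ω ^ 2 ∂μ = 1)
    (hV : ∀ k ∈ Finset.range (2 * p + 1), IsDegenerateUStatistic μ Z X k (V k) (G k))
    (huG : (fun ω => F ω ^ 2) =ᵐ[μ] fun ω => ∑ k ∈ Finset.range (2 * p + 1), G k ω) {R : ℝ}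
    (hR : HasSum (fun a => ∫ ω, coordResidual μ Z X a F ω ^ 4 ∂μ) R)
    {f f' : ℝ → ℝ} {b c : ℝ} (hf : ∀ x, HasDerivAt f (f' x) x) (hb : ∀ x, |f x| ≤ b)
    (hc : ∀ x, |f' x| ≤ c) (hlip : ∀ x y, |f' x - f' y| ≤ 4 * |x - y|) {η : ℝ} (hη : 0 < η) :
    |∫ ω, F ω * f (F ω) ∂μ - ∫ ω, f' (F ω) * normalizedCarreDuChamp p G ω ∂μ|
      ≤ 4 * (η + η⁻¹ * (R / p)) := by
  have hp0 : (0 : ℝ) < p := by exact_mod_cast hp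
  have hf'c : Continuous f' := (LipschitzWith.of_dist_le_mul (K := 4) fun x y => by
    simpa [Real.dist_eq] using hlip x y).continuous
  have hfc : Continuous f := continuous_iff_continuousAt.2 fun x => (hf x).continuousAt
  have m1 : MemLp (fun ω => f (F ω)) 2 μ := MemLp.comp_of_abs_le hfc hb hF4.1 2
  have m2 : MemLp (fun ω => f' (F ω)) 2 μ := MemLp.comp_of_abs_le hf'c hc hF4.1 2
  have m3 : MemLp (fun ω => F ω * f' (F ω)) 2 μ :=
    hF4.mul_memLp_two (MemLp.comp_of_abs_le hf'c hc hF4.1 4)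
  have mu := hF4.sq_memLp_two
  have mD : ∀ a, MemLp (coordResidual μ Z X a F) 2 μ := fun a =>
    hF.memLp_two.condResidual one_le_two
  have hs1 := hF.hasSum_integral_coordResidual_mul hG m1
  have hs2 := hF.hasSum_integral_coordResidual_mul hG m3
  have hs3 := hasSum_integral_coordResidual_sum_mul hG hV mu huG m2
  have hs4 := ((hF.hasSum_integral_coordResidual_sq hG).mul_left η).add (hR.mul_left η⁻¹)
  have hbd := HasSum.norm_le_of_bounded (hs1.sub (hs2.sub (hs3.div_const 2))) (hs4.mul_left 4)
    fun a => by
      have h := abs_integral_condResidual_mul_comp_sub_le (hG {a}ᶜ) hF4 hf hb hf'c hc hlip hη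
      have e : ∫ ω, f' (F ω) * (F ω * coordResidual μ Z X a F ω
          - coordResidual μ Z X a (fun ω => F ω ^ 2) ω / 2) ∂μ
          = ∫ ω, coordResidual μ Z X a F ω * (F ω * f' (F ω)) ∂μ
            - (∫ ω, coordResidual μ Z X a (fun ω => F ω ^ 2) ω * f' (F ω) ∂μ) / 2 := by
        rw [← integral_div, ← integral_sub ((mD a).integrable_mul_two m3)
          (((mu.condResidual one_le_two).integrable_mul_two m2).div_const 2)]
        congr 1; ext ω; ring
      rw [e] at h
      exact h
  have hΓ : ∫ ω, f' (F ω) * normalizedCarreDuChamp p G ω ∂μ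
      = ∫ ω, F ω * (F ω * f' (F ω)) ∂μ
        - (∑ k ∈ Finset.range (2 * p + 1), k * ∫ ω, G k ω * f' (F ω) ∂μ) / (2 * p) := by
    have i : ∀ k ∈ Finset.range (2 * p + 1), Integrable (fun ω => G k ω * f' (F ω)) μ :=
      fun k hk => (hV k hk).memLp_two.integrable_mul_two m2
    have e1 : ∫ ω, F ω * (F ω * f' (F ω)) ∂μ
        = ∑ k ∈ Finset.range (2 * p + 1), ∫ ω, G k ω * f' (F ω) ∂μ := by
      rw [← integral_finsetSum _ i]
      refine integral_congr_ae ?_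
      filter_upwards [huG] with ω hω
      rw [← Finset.sum_mul, ← hω]; ring
    have e2 : ∫ ω, f' (F ω) * normalizedCarreDuChamp p G ω ∂μ
        = ∑ k ∈ Finset.range (2 * p + 1), (1 - k / (2 * p)) * ∫ ω, G k ω * f' (F ω) ∂μ := by
      simp only [← integral_const_mul]
      rw [← integral_finsetSum _ fun k hk => (i k hk).const_mul _]
      congr 1; ext ω
      rw [normalizedCarreDuChamp, Finset.mul_sum]
      exact Finset.sum_congr rfl fun k _ => by ring
    rw [e1, e2, Finset.sum_div, ← Finset.sum_sub_distrib]
    exact Finset.sum_congr rfl fun k _ => by ring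
  rw [hvar, Real.norm_eq_abs] at hbd
  rw [hΓ]
  have hfac : ∀ x y z : ℝ, p * x - (p * y - z / 2) = p * (x - (y - z / (2 * p))) := fun x y z => by
    field_simp
  rw [hfac, abs_mul, abs_of_pos hp0, ← le_div_iff₀' hp0] at hbd
  refine hbd.trans (le_of_eq ?_)
  field_simp

end CarreDuChamp

/-! ### The Wasserstein bound -/

section Bound

variable {Ω A E₀ : Type*} {E : A → Type*} [MeasurableSpace E₀] [∀ a, MeasurableSpace (E a)]
  {Z : Ω → E₀} {X : ∀ a, Ω → E a} {mΩ : MeasurableSpace Ω} {μ : Measure Ω}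
  [IsProbabilityMeasure μ] {p : ℕ} {W : Finset A → Ω → ℝ} {F : Ω → ℝ}

/-- The fourth moments of the residuals sum up to a multiple of the squared maximal influence. -/
lemma IsDegenerateUStatistic.exists_hasSum_coordResidual_pow_four [Countable A]
    (hG : ∀ K, condSigma Z X K ≤ mΩ) (hF : IsDegenerateUStatistic μ Z X p W F)
    (hF4 : MemLp F 4 μ) (hvar : ∫ ω, F ω ^ 2 ∂μ = 1) {κ : ℝ} (hκ : IsHypercontractive μ p W κ) :
    ∃ R, HasSum (fun a => ∫ ω, coordResidual μ Z X a F ω ^ 4 ∂μ) R ∧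
      R ≤ (4 ^ p * (√κ * maxInfluence μ p W)) ^ 2 * p := by
  have hI := hF.hasSum_integral_coordResidual_sq hG
  rw [hvar, mul_one] at hI
  have hle : ∀ a, ∫ ω, coordResidual μ Z X a F ω ^ 4 ∂μ
      ≤ (4 ^ p * (√κ * maxInfluence μ p W)) ^ 2 * ∫ ω, coordResidual μ Z X a F ω ^ 2 ∂μ :=
    fun a => by
      have h1 := hF.integral_coordResidual_pow_four_le hG hF4 hκ a
      have h2 := hF.integral_coordResidual_sq_le_maxInfluence_sq hG a
      have h3 : 0 ≤ ∫ ω, coordResidual μ Z X a F ω ^ 2 ∂μ := integral_nonneg fun ω => sq_nonneg _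
      calc _ ≤ _ := h1
        _ = (4 ^ p * √κ) ^ 2 * ((∫ ω, coordResidual μ Z X a F ω ^ 2 ∂μ)
            * ∫ ω, coordResidual μ Z X a F ω ^ 2 ∂μ) := by ring
        _ ≤ (4 ^ p * √κ) ^ 2 * (maxInfluence μ p W ^ 2
            * ∫ ω, coordResidual μ Z X a F ω ^ 2 ∂μ) := by gcongr
        _ = _ := by ring
  have hsum := Summable.of_nonneg_of_le
    (fun a => integral_nonneg fun ω => by positivity) hle (hI.mul_left _).summable
  exact ⟨_, hsum.hasSum, hasSum_le hle hsum.hasSum (hI.mul_left _)⟩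

/-- The Wasserstein bound, with the explicit constant `5 * 4 ^ p + 4 * 16 ^ p`. -/
lemma IsDegenerateUStatistic.wassersteinDist_gaussianReal_le [Countable A]
    (hG : ∀ K, condSigma Z X K ≤ mΩ) (hp : 1 ≤ p) (hF : IsDegenerateUStatistic μ Z X p W F)
    (hF4 : MemLp F 4 μ) (hvar : ∫ ω, F ω ^ 2 ∂μ = 1) {κ : ℝ} (hκ : IsHypercontractive μ p W κ)
    (hegf : IsChaosEigenfunction μ Z X p F) :
    wassersteinDist (μ.map F) (gaussianReal 0 1) ≤ ENNReal.ofReal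
      (√(2 / (3 * Real.pi)) * √|∫ ω, F ω ^ 4 ∂μ - 3|
        + (5 * 4 ^ p + 4 * (4 ^ p) ^ 2) * √κ * maxInfluence μ p W) := by
  have hFm : AEMeasurable F μ := hF4.1.aemeasurable
  have : IsProbabilityMeasure (μ.map F) := Measure.isProbabilityMeasure_map hFm
  have hp0 : (0 : ℝ) < p := by exact_mod_cast hp
  have hF1 := hF.memLp_two.integrable one_le_two
  obtain ⟨G, hGch, huG⟩ := hegf
  choose! V hV' using hGch
  have hV : ∀ k ∈ Finset.range (2 * p + 1), IsDegenerateUStatistic μ Z X k (V k) (G k) :=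
    fun k hk => hV' k (Nat.lt_succ_iff.1 (Finset.mem_range.1 hk))
  obtain ⟨R, hR, hRle⟩ := hF.exists_hasSum_coordResidual_pow_four hG hF4 hvar hκ
  set t := √κ * maxInfluence μ p W with ht
  have ht0 : 0 ≤ t := mul_nonneg (Real.sqrt_nonneg _) (Real.sqrt_nonneg _)
  have hRp : R / p ≤ (4 ^ p * t) ^ 2 := (div_le_iff₀ hp0).2 hRle
  have mΓ := memLp_normalizedCarreDuChamp hV
  have m1Γ : MemLp (fun ω => 1 - normalizedCarreDuChamp p G ω) 2 μ := (memLp_const 1).sub mΓ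
  refine wassersteinDist_le_of_smooth
    ((integrable_map_measure aestronglyMeasurable_id hFm).2 hF1)
    ((memLp_id_gaussianReal' 1 (by simp)).integrable le_rfl)
    fun h h' h'' b hh hh' hc' hb' hb'' => ?_
  obtain ⟨f, f', hf, hst, hfb, hfb', hlip⟩ := exists_stein_solution hh hh' hc' hb' hb''
  have hhc : Continuous h := continuous_iff_continuousAt.2 fun x => (hh x).continuousAt
  have hfc : Continuous f := continuous_iff_continuousAt.2 fun x => (hf x).continuousAt
  have hf'c : Continuous f' := (LipschitzWith.of_dist_le_mul (K := 4) fun x y => by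
    simpa [Real.dist_eq] using hlip x y).continuous
  have m1 : MemLp (fun ω => f (F ω)) 2 μ := MemLp.comp_of_abs_le hfc hfb hF4.1 2
  have m2 : MemLp (fun ω => f' (F ω)) 2 μ := MemLp.comp_of_abs_le hf'c hfb' hF4.1 2
  have i1 := hF.memLp_two.integrable_mul_two m1
  have i2 := m2.integrable one_le_two
  have i3 := m2.integrable_mul_two mΓ
  have hmap : ∫ x, h x ∂(μ.map F) - ∫ x, h x ∂(gaussianReal 0 1)
      = ∫ ω, f' (F ω) * (1 - normalizedCarreDuChamp p G ω) ∂μ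
        - (∫ ω, F ω * f (F ω) ∂μ - ∫ ω, f' (F ω) * normalizedCarreDuChamp p G ω ∂μ) := by
    have e : ∀ ω, h (F ω) = (f' (F ω) - F ω * f (F ω)) + ∫ x, h x ∂(gaussianReal 0 1) :=
      fun ω => by rw [hst]; ring
    rw [integral_map hFm hhc.aestronglyMeasurable, integral_congr_ae (.of_forall e),
      integral_add (i2.sub' i1) (integrable_const _), integral_sub i2 i1]
    simp only [mul_sub, mul_one]
    rw [integral_sub i2 i3]
    simp
  -- the two parts of the bound: the carré du champ, and the Taylor remainder
  have hA : |∫ ω, f' (F ω) * (1 - normalizedCarreDuChamp p G ω) ∂μ|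
      ≤ √(2 / (3 * Real.pi)) * √|∫ ω, F ω ^ 4 ∂μ - 3| + 4 ^ p * t := by
    have hvarΓ := integral_one_sub_normalizedCarreDuChamp_sq_le hG hp hF hF4 hvar hV huG hR
    have hsup : ∫ ω, f' (F ω) ^ 2 ∂μ ≤ 2 / Real.pi := by
      have : ∫ ω, f' (F ω) ^ 2 ∂μ ≤ ∫ _, 2 / Real.pi ∂μ :=
        integral_mono m2.integrable_sq (integrable_const _) fun ω => by
          rw [← Real.sq_sqrt (by positivity : (0 : ℝ) ≤ 2 / Real.pi), ← sq_abs]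
          exact pow_le_pow_left₀ (abs_nonneg _) (hfb' _) 2
      simpa using this
    have hpi : 2 / Real.pi ≤ 1 := (div_le_one Real.pi_pos).2 Real.two_le_pi
    have hR' : 2 / (3 * p) * R ≤ (4 ^ p * t) ^ 2 := by
      have : 2 / (3 * p) * R = 2 / 3 * (R / p) := by field_simp
      rw [this]
      nlinarith [sq_nonneg (4 ^ p * t)]
    have h1 : ∫ ω, (1 - normalizedCarreDuChamp p G ω) ^ 2 ∂μ
        ≤ |∫ ω, F ω ^ 4 ∂μ - 3| / 3 + (4 ^ p * t) ^ 2 := by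
      have := le_abs_self (∫ ω, F ω ^ 4 ∂μ - 3)
      linarith
    calc |∫ ω, f' (F ω) * (1 - normalizedCarreDuChamp p G ω) ∂μ|
        ≤ √(∫ ω, f' (F ω) ^ 2 ∂μ) * √(∫ ω, (1 - normalizedCarreDuChamp p G ω) ^ 2 ∂μ) :=
          abs_integral_mul_le m2 m1Γ
      _ ≤ √(2 / Real.pi) * √(|∫ ω, F ω ^ 4 ∂μ - 3| / 3 + (4 ^ p * t) ^ 2) := by gcongr
      _ ≤ √(2 / Real.pi) * (√(|∫ ω, F ω ^ 4 ∂μ - 3| / 3) + √((4 ^ p * t) ^ 2)) := by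
          gcongr
          refine Real.sqrt_le_iff.2 ⟨by positivity, ?_⟩
          have := Real.sq_sqrt (by positivity : 0 ≤ |∫ ω, F ω ^ 4 ∂μ - 3| / 3)
          have := Real.sq_sqrt (by positivity : 0 ≤ (4 ^ p * t) ^ 2)
          have : 0 ≤ √(|∫ ω, F ω ^ 4 ∂μ - 3| / 3) * √((4 ^ p * t) ^ 2) := by positivity
          nlinarith
      _ = √(2 / (3 * Real.pi)) * √|∫ ω, F ω ^ 4 ∂μ - 3| + √(2 / Real.pi) * (4 ^ p * t) := by
          rw [mul_add, Real.sqrt_sq (by positivity), ← Real.sqrt_mul (by positivity),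
            ← Real.sqrt_mul (by positivity)]
          congr 2; field_simp
      _ ≤ _ := by
          have h4t : 0 ≤ 4 ^ p * t := by positivity
          have := mul_le_of_le_one_left h4t (Real.sqrt_le_one.2 hpi)
          linarith
  have hB : |∫ ω, F ω * f (F ω) ∂μ - ∫ ω, f' (F ω) * normalizedCarreDuChamp p G ω ∂μ|
      ≤ 4 * (t + (4 ^ p) ^ 2 * t) := by
    -- the optimal parameter is `η = t`, which may vanish
    refine le_of_forall_pos_le_add fun δ hδ => ?_
    have hη : 0 < t + δ / 4 := by positivity
    refine (abs_integral_mul_sub_integral_mul_normalizedCarreDuChamp_le hG hp hF hF4 hvar hV huG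
      hR hf hfb hfb' hlip hη).trans ?_
    have h1 : (t + δ / 4)⁻¹ * (R / p) ≤ (4 ^ p) ^ 2 * t := by
      rw [inv_mul_le_iff₀ hη]
      have : 0 ≤ δ / 4 * ((4 ^ p) ^ 2 * t) := by positivity
      nlinarith
    linarith
  rw [hmap]
  refine (abs_sub _ _).trans ((add_le_add hA hB).trans ?_)
  have h4p : (1 : ℝ) ≤ 4 ^ p := one_le_pow₀ (by norm_num)
  have : (5 * 4 ^ p + 4 * (4 ^ p) ^ 2) * √κ * maxInfluence μ p W
      = (5 * 4 ^ p + 4 * (4 ^ p) ^ 2) * t := by rw [ht]; ring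
  rw [this]
  nlinarith

end Bound


theorem mainTheorem8 (p : ℕ) (hp : 1 ≤ p) :
    ∃ C : ℝ, 0 < C ∧
      ∀ (Ω : Type*) [MeasurableSpace Ω] [StandardBorelSpace Ω]
        (μ : Measure Ω) [IsProbabilityMeasure μ]
        (A : Type*) [Countable A]
        (E₀ : Type*) [MeasurableSpace E₀] [StandardBorelSpace E₀]
        (E : A → Type*) [∀ a, MeasurableSpace (E a)] [∀ a, StandardBorelSpace (E a)]
        (Z : Ω → E₀) (X : ∀ a, Ω → E a) (hZ : Measurable Z) (_hX : ∀ a, Measurable (X a))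
        (_hind : iCondIndepFun (MeasurableSpace.comap Z inferInstance) hZ.comap_le X μ)
        (F : Ω → ℝ) (W : Finset A → Ω → ℝ) (κ : ℝ)
        (_hF4 : MemLp F 4 μ)
        (_hU : IsDegenerateUStatistic μ Z X p W F)
        (_hmean : μ[F | MeasurableSpace.comap Z inferInstance] =ᵐ[μ] 0)
        (_hvar : ∫ ω, F ω ^ 2 ∂μ = 1)
        (_hHC : IsHypercontractive μ p W κ)
        (_hEGF : IsChaosEigenfunction μ Z X p F),
        wassersteinDist (μ.map F) (gaussianReal 0 1) ≤
          ENNReal.ofReal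
            (√(2 / (3 * Real.pi)) * √|∫ ω, F ω ^ 4 ∂μ - 3| + C * √κ * maxInfluence μ p W) := by

  refine ⟨5 * 4 ^ p + 4 * (4 ^ p) ^ 2, by positivity, ?_⟩
  intro Ω _ _ μ _ A _ E₀ _ _ E _ _ Z X hZ hX _ F W κ hF4 hU _ hvar hHC hEGF
  exact hU.wassersteinDist_gaussianReal_le (condSigma_le hZ hX) hp hF4 hvar hHC hEGF
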